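/- **Setup.** Let $n$ be an even non-negative integer, $g\ge 0$ an integer divisible by $4$, and $r$ an odd positive integer divisible by $3$. For $x\in\mathbb Z^r$ and $1\le t\le r$ put $$\ell_t(x)=\sum_{s=t}^{r}\Bigl(x_s-\bigl(\tfrac n2-g\bigr)\Bigr)-\tfrac{gr}{4},\qquad h(x)=\sum_{i=1}^r x_i-\Bigl(\max\bigl(0,\max_{a\text{ odd}}\ell_a(x)\bigr)+\max\bigl(0,\max_{b\text{ even}}\ell_b(x)\bigr)\Bigr).$$ Let $L=\{\tfrac{2r}{3}+1,\dots,r\}$ be the last $r/3$ indices, let $\bar x_i=\min(x_i,\tfrac n2-\tfrac g4)$ for $i\in L$ and $\bar x_i=x_i$ for $i\notin L$, and define $$h^{*\prime}(x)=h(\bar x)-\sum_{i\in L}\max\bigl(0,\;x_i-(\tfrac n2-\tfrac g4)\bigr).$$ For a partition $P=(P_1,\dots,P_r)$ of a finite set $U$ into parts of size $n$, let $f_P(S)=h(|S\cap P_1|,\dots,|S\cap P_r|)$ and $f^{*\prime}_P(S)=h^{*\prime}(|S\cap P_1|,\dots,|S\cap P_r|)$. For $1\le i<r$, a point $x\in\{0,\dots,n\}^r$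 is *$i$-balanced* if $x_i-\frac g8\le x_j\le x_i+\frac g8$ for all $j>i$. **Statement.** 1. *(The modified function.)* * $h^{*\prime}$ is submodular on the hypergrid $\{0,\dots,n\}^r$, and each $f^{*\prime}_P$ is a submodular set function. * *(Suffix indistinguishability.)* If $1\le i<r/2$ and $x,x'\in\{0,\dots,n\}^r$ are $i$-balanced with $x_j=x'_j$ for all $j\le i$ and $\sum_j x_j=\sum_j x'_j$, then $h^{*\prime}(x)=h^{*\prime}(x')=h(x)=h(x')$. * If $5gr\le n$, then the minimum of $f_P$ is $f_P(\emptyset)=0$, while the union $\bigcup_{i\in L}P_i$ of the last third of the parts is a minimizer of $f^{*\prime}_P$, with value $-gr/6$. 2. *(Size of the gap.)* There are absolute constants $C_1,C_2>0$ such that, whenever $c\ge1$ is real, $n$ is even, $4\mid g$, $200\sqrt{cn\log n}\le g\le 800\sqrt{cn\log n}$, and $r$ is the largest odd multiple of $3$ with $5gr\le n$, then for $N=nr$ $$C_1\,N^{2/3}(c\log N)^{1/3}\;\le\;\frac{gr}{6}\;\le\;C_2\,N^{2/3}(c\log N)^{1/3}.$$ 3. *(Lower bound for approximate minimization.)* There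 is an absolute constant $\kappa>0$ such that the following holds for every integer $N\ge2$, all reals $c\ge1$ and $0<\varepsilon\le1$, and every integer $s\ge0$. Suppose that a (possibly randomized) algorithm with access to an evaluation oracle for a function $f:2^{[N]}\to[-1,1]$ uses at most $s$ rounds of adaptivity (the queries of a round depend only on the answers in previous rounds and on the randomness) with at most $N^c$ queries per round, and returns, for every submodular $f$, with probability at least $2/3$, a set $S$ with $f(S)\le\min_T f(T)+\varepsilon$. Then $$s\;\ge\;\kappa\cdot\min\Bigl\{\frac1\varepsilon,\;\Bigl(\frac{N}{c\log N}\Bigr)^{1/3}\Bigr\}.$$ In particular, for constant $c$ (polynomially many queries), $\Omega(1/\varepsilon)$ rounds are needed for all $\varepsilon\ge (c\log N/N)^{1/3}=\tilde\Theta(N^{-1/3})$. -/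

import Mathlib

open Finset MeasureTheory

/-- Submodularity of a set function by decreasing marginals. -/
def IsSubmodular {U R : Type*} [DecidableEq U] [Sub R] [LE R] (f : Finset U → R) : Prop :=
  ∀ (A B : Finset U) (e : U), A ⊆ B → e ∉ B → f (insert e B) - f B ≤ f (insert e A) - f A

/-! ### The hypergrid functions

Coordinates `1, …, r` of the hypergrid are the elements of `Fin r`, so that `i : Fin r` stands for
the coordinate number `i + 1`.  The functions are only used when `n` is even and `4 ∣ g`, so that
the integer divisions below are exact. -/

/-- The hypergrid `{0, …, n}^r`. -/
def InGrid (n : ℕ) {r : ℕ} (x : Fin r → ℤ) : Prop := ∀ i, 0 ≤ x i ∧ x i ≤ n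

/-- Submodularity on the hypergrid `{0, …, n}^r`: `∂_j h (x + e_i) ≤ ∂_j h (x)`. -/
def IsGridSubmodular (n : ℕ) {r : ℕ} (h : (Fin r → ℤ) → ℤ) : Prop :=
  ∀ (x : Fin r → ℤ) (i j : Fin r), InGrid n x → InGrid n (x + Pi.single i 1 + Pi.single j 1) →
    h (x + Pi.single i 1 + Pi.single j 1) - h (x + Pi.single i 1) ≤ h (x + Pi.single j 1) - h x

/-- The suffix function `ℓ_t(x) = ∑_{s ≥ t} (x_s - (n/2 - g)) - g r / 4`. -/
def suffixFn (n g r : ℕ) (t : Fin r) (x : Fin r → ℤ) : ℤ :=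
  (∑ s ∈ univ.filter (fun s : Fin r => t ≤ s), (x s - ((n : ℤ) / 2 - g))) - (g : ℤ) * r / 4

/-- The maximum of `0` and of all `φ t` with `t ∈ s`. -/
def maxWithZero {r : ℕ} (s : Finset (Fin r)) (φ : Fin r → ℤ) : ℤ := s.fold max 0 φ

/-- `h(x) = ‖x‖₁ - (max(0, max_{a odd} ℓ_a(x)) + max(0, max_{b even} ℓ_b(x)))`. -/
def hFun (n g r : ℕ) (x : Fin r → ℤ) : ℤ :=
  (∑ i, x i) -
    (maxWithZero (univ.filter fun t : Fin r => Odd ((t : ℕ) + 1)) (fun t => suffixFn n g r t x) +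
      maxWithZero (univ.filter fun t : Fin r => Even ((t : ℕ) + 1)) (fun t => suffixFn n g r t x))

/-- The last `r / 3` coordinates (when `3 ∣ r`): those with number greater than `2 r / 3`. -/
def lastThird (r : ℕ) : Finset (Fin r) := univ.filter fun i : Fin r => 2 * r < 3 * ((i : ℕ) + 1)

/-- Truncation of the coordinates of the last third at `n/2 - g/4`. -/
def truncLast (n g r : ℕ) (x : Fin r → ℤ) : Fin r → ℤ := fun i =>
  if i ∈ lastThird r then min (x i) ((n : ℤ) / 2 - (g : ℤ) / 4) else x i

/-- The modified function `h*'`, which treats the last third of the coordinates separately. -/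
def hStarPrime (n g r : ℕ) (x : Fin r → ℤ) : ℤ :=
  hFun n g r (truncLast n g r x) -
    ∑ i ∈ lastThird r, max 0 (x i - ((n : ℤ) / 2 - (g : ℤ) / 4))

/-- `x` is balanced from coordinate `i` on: `x_i - g/8 ≤ x_j ≤ x_i + g/8` for all `j > i`. -/
def IsBalanced (g : ℕ) {r : ℕ} (i : Fin r) (x : Fin r → ℤ) : Prop :=
  ∀ j, i < j → (x i : ℝ) - (g : ℝ) / 8 ≤ x j ∧ (x j : ℝ) ≤ x i + (g : ℝ) / 8

/-- `P` is an ordered partition of the universe into parts of size `n`. -/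
def IsEquipartition {U : Type*} [Fintype U] [DecidableEq U] (n : ℕ) {r : ℕ}
    (P : Fin r → Finset U) : Prop :=
  (∀ i, (P i).card = n) ∧ (∀ i j, i ≠ j → Disjoint (P i) (P j)) ∧ univ.biUnion P = univ

/-- The set function induced by a partition and a hypergrid function. -/
def inducedFn {U : Type*} [DecidableEq U] {r : ℕ} (P : Fin r → Finset U)
    (h : (Fin r → ℤ) → ℤ) (S : Finset U) : ℤ :=
  h fun i => ((S ∩ P i).card : ℤ)

/-! ### Round-based algorithms with an evaluation oracle -/

/-- Deterministic algorithms over the universe `U` with at most `s` rounds of adaptivity and at most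
`q` evaluation queries per round.  In a round, the algorithm submits a set `Q` of queries, receives
all the answers, and goes on in a way that depends on them; it ends by returning a set. -/
inductive RoundAlg (U : Type) (q : ℝ) : ℕ → Type
  | output {s : ℕ} (S : Finset U) : RoundAlg U q s
  | round {s : ℕ} (Q : Finset (Finset U)) (hQ : (Q.card : ℝ) ≤ q)
      (next : ({S // S ∈ Q} → ℝ) → RoundAlg U q s) : RoundAlg U q (s + 1)

/-- The set returned by the algorithm when the oracle evaluates `f`. -/
def RoundAlg.run {U : Type} {q : ℝ} (f : Finset U → ℝ) : {s : ℕ} → RoundAlg U q s → Finset U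
  | _, .output S => S
  | _, .round _ _ next => (next fun S => f S.1).run f

/-- `S` minimizes `f` up to an additive error `ε`. -/
def IsApproxMinimizer {U : Type*} (f : Finset U → ℝ) (ε : ℝ) (S : Finset U) : Prop :=
  ∀ T, f S ≤ f T + ε

/-- The randomized algorithm `A` (a random choice of a deterministic one) returns, on each submodular
function with values in `[-1, 1]`, an `ε`-additive approximate minimizer with probability at
least `2/3`. -/
def SolvesApproxSFM {U : Type} [DecidableEq U] {q : ℝ} {s : ℕ} {Ω : Type*} [MeasurableSpace Ω]
    (μ : Measure Ω) (A : Ω → RoundAlg U q s) (ε : ℝ) : Prop :=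
  ∀ f : Finset U → ℝ, IsSubmodular f → (∀ S, -1 ≤ f S ∧ f S ≤ 1) →
    MeasurableSet {ω | IsApproxMinimizer f ε ((A ω).run f)} ∧
      2 / 3 ≤ μ.real {ω | IsApproxMinimizer f ε ((A ω).run f)}

theorem maxWithZero_le_iff {r : ℕ} {s : Finset (Fin r)} {φ : Fin r → ℤ} {c : ℤ} :
    maxWithZero s φ ≤ c ↔ 0 ≤ c ∧ ∀ t ∈ s, φ t ≤ c := by
  unfold maxWithZero; exact Finset.fold_max_le c

theorem maxWithZero_nonneg {r : ℕ} (s : Finset (Fin r)) (φ : Fin r → ℤ) :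
    0 ≤ maxWithZero s φ := (maxWithZero_le_iff.1 le_rfl).1

theorem le_maxWithZero {r : ℕ} {s : Finset (Fin r)} (φ : Fin r → ℤ) {t : Fin r} (ht : t ∈ s) :
    φ t ≤ maxWithZero s φ := (maxWithZero_le_iff.1 le_rfl).2 t ht

theorem maxWithZero_attained {r : ℕ} (s : Finset (Fin r)) (φ : Fin r → ℤ) :
    maxWithZero s φ = 0 ∨ ∃ t ∈ s, maxWithZero s φ = φ t := by
  have h : maxWithZero s φ ≤ maxWithZero s φ := le_rfl
  nth_rewrite 2 [maxWithZero] at h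
  rcases (Finset.le_fold_max _).1 h with h | ⟨t, ht, h⟩
  · exact Or.inl (le_antisymm h (maxWithZero_nonneg s φ))
  · exact Or.inr ⟨t, ht, le_antisymm h (le_maxWithZero φ ht)⟩

theorem maxWithZero_mono {r : ℕ} {s : Finset (Fin r)} {φ ψ : Fin r → ℤ}
    (h : ∀ t ∈ s, φ t ≤ 0 ∨ ∃ u ∈ s, φ t ≤ ψ u) : maxWithZero s φ ≤ maxWithZero s ψ := by
  refine maxWithZero_le_iff.2 ⟨maxWithZero_nonneg _ _, fun t ht => ?_⟩
  rcases h t ht with h | ⟨u, hu, h⟩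
  · exact h.trans (maxWithZero_nonneg _ _)
  · exact h.trans (le_maxWithZero ψ hu)

theorem suffixFn_eq {n g r : ℕ} (t : Fin r) (x : Fin r → ℤ) :
    suffixFn n g r t x =
      (∑ s, if t ≤ s then x s - ((n : ℤ) / 2 - g) else 0) - (g : ℤ) * r / 4 := by
  rw [suffixFn, Finset.sum_filter]

theorem suffixFn_add_single {n g r : ℕ} (t i : Fin r) (x : Fin r → ℤ) :
    suffixFn n g r t (x + Pi.single i 1) = suffixFn n g r t x + if t ≤ i then 1 else 0 := by
  have : (∑ s ∈ univ.filter (fun s : Fin r => t ≤ s), (Pi.single i (1 : ℤ) : Fin r → ℤ) s) =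
      if t ≤ i then 1 else 0 := by
    simp [Pi.single_apply, Finset.sum_ite_eq']
  rw [← this]
  simp only [suffixFn, Pi.add_apply, Finset.sum_sub_distrib, Finset.sum_add_distrib]
  ring

section suffixMax
variable {n g r : ℕ} (s : Finset (Fin r))

/-- The maximum over suffixes, as a function on the hypergrid, is supermodular. -/
theorem maxWithZero_suffixFn_supermodular (x : Fin r → ℤ) (i j : Fin r) :
    maxWithZero s (fun t => suffixFn n g r t (x + Pi.single i 1)) +
      maxWithZero s (fun t => suffixFn n g r t (x + Pi.single j 1)) ≤
    maxWithZero s (fun t => suffixFn n g r t x) +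
      maxWithZero s (fun t => suffixFn n g r t (x + Pi.single i 1 + Pi.single j 1)) := by
  have h0 := maxWithZero_nonneg s (fun t => suffixFn n g r t x)
  have h1 := maxWithZero_nonneg s (fun t => suffixFn n g r t (x + Pi.single i 1 + Pi.single j 1))
  have hx : ∀ t ∈ s, _ := fun t ht => le_maxWithZero (fun t => suffixFn n g r t x) ht
  have hy : ∀ t ∈ s, _ := fun t ht =>
    le_maxWithZero (fun t => suffixFn n g r t (x + Pi.single i 1 + Pi.single j 1)) ht
  simp only [suffixFn_add_single] at *
  rcases maxWithZero_attained s (fun t => suffixFn n g r t x + if t ≤ i then 1 else 0) with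
    ha | ⟨a, has, ha⟩ <;>
  rcases maxWithZero_attained s (fun t => suffixFn n g r t x + if t ≤ j then 1 else 0) with
    hb | ⟨b, hbs, hb⟩ <;> rw [ha, hb]
  · omega
  · have := hy b hbs
    grind
  · have := hy a has
    grind
  · rcases le_total a b with hab | hab
    · have h2 := hy a has
      have h3 := hx b hbs
      grind
    · have h2 := hy b hbs
      have h3 := hx a has
      grind

theorem maxWithZero_suffixFn_add_single (x : Fin r → ℤ) (i : Fin r) :
    maxWithZero s (fun t => suffixFn n g r t x) ≤
      maxWithZero s (fun t => suffixFn n g r t (x + Pi.single i 1)) ∧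
    maxWithZero s (fun t => suffixFn n g r t (x + Pi.single i 1)) ≤
      maxWithZero s (fun t => suffixFn n g r t x) + 1 := by
  simp only [suffixFn_add_single]
  refine ⟨maxWithZero_mono fun t ht => Or.inr ⟨t, ht, by split_ifs <;> omega⟩,
    maxWithZero_le_iff.2 ⟨?_, fun t ht => ?_⟩⟩
  · have := maxWithZero_nonneg s (fun t => suffixFn n g r t x)
    omega
  · have := le_maxWithZero (fun t => suffixFn n g r t x) ht
    split_ifs <;> grind

end suffixMax

theorem sum_add_single {r : ℕ} (x : Fin r → ℤ) (i : Fin r) :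
    ∑ k, (x + Pi.single i 1 : Fin r → ℤ) k = ∑ k, x k + 1 := by
  simp [Finset.sum_add_distrib]

theorem hFun_submodular (n g r : ℕ) (x : Fin r → ℤ) (i j : Fin r) :
    hFun n g r (x + Pi.single i 1 + Pi.single j 1) - hFun n g r (x + Pi.single i 1) ≤
      hFun n g r (x + Pi.single j 1) - hFun n g r x := by
  have h1 := maxWithZero_suffixFn_supermodular (n := n) (g := g)
    (univ.filter fun t : Fin r => Odd ((t : ℕ) + 1)) x i j
  have h2 := maxWithZero_suffixFn_supermodular (n := n) (g := g)
    (univ.filter fun t : Fin r => Even ((t : ℕ) + 1)) x i j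
  unfold hFun
  rw [sum_add_single, sum_add_single, sum_add_single]
  omega

theorem neg_one_le_hFun_marginal (n g r : ℕ) (x : Fin r → ℤ) (i : Fin r) :
    -1 ≤ hFun n g r (x + Pi.single i 1) - hFun n g r x := by
  have h1 := maxWithZero_suffixFn_add_single (n := n) (g := g)
    (univ.filter fun t : Fin r => Odd ((t : ℕ) + 1)) x i
  have h2 := maxWithZero_suffixFn_add_single (n := n) (g := g)
    (univ.filter fun t : Fin r => Even ((t : ℕ) + 1)) x i
  unfold hFun
  rw [sum_add_single]
  omega

/-- The coordinates of the last third that have reached the truncation level. -/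
def Saturated (n g : ℕ) {r : ℕ} (x : Fin r → ℤ) (i : Fin r) : Prop :=
  i ∈ lastThird r ∧ (n : ℤ) / 2 - (g : ℤ) / 4 ≤ x i

theorem truncLast_add_single_of_saturated {n g r : ℕ} {x : Fin r → ℤ} {i : Fin r}
    (h : Saturated n g x i) : truncLast n g r (x + Pi.single i 1) = truncLast n g r x := by
  obtain ⟨h1, h2⟩ := h
  funext k
  by_cases hk : k = i
  · subst hk; simp [truncLast, h1]; omega
  · simp [truncLast, hk]

theorem truncLast_add_single_of_not_saturated {n g r : ℕ} {x : Fin r → ℤ} {i : Fin r}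
    (h : ¬ Saturated n g x i) :
    truncLast n g r (x + Pi.single i 1) = truncLast n g r x + Pi.single i 1 := by
  funext k
  by_cases hk : k = i
  · subst hk
    by_cases h1 : k ∈ lastThird r
    · have h2 : ¬ (n : ℤ) / 2 - (g : ℤ) / 4 ≤ x k := fun h2 => h ⟨h1, h2⟩
      simp [truncLast, h1]; omega
    · simp [truncLast, h1]
  · simp [truncLast, hk]

open Classical in
theorem excess_add_single {n g r : ℕ} (x : Fin r → ℤ) (i : Fin r) :
    ∑ k ∈ lastThird r, max 0 ((x + Pi.single i 1 : Fin r → ℤ) k - ((n : ℤ) / 2 - (g : ℤ) / 4)) =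
      ∑ k ∈ lastThird r, max 0 (x k - ((n : ℤ) / 2 - (g : ℤ) / 4)) +
        if Saturated n g x i then 1 else 0 := by
  have : (if Saturated n g x i then (1 : ℤ) else 0) =
      ∑ k ∈ lastThird r, if k = i then (if Saturated n g x i then (1 : ℤ) else 0) else 0 := by
    rw [Finset.sum_ite_eq']
    by_cases hi : i ∈ lastThird r <;> simp [Saturated, hi]
  rw [this, ← Finset.sum_add_distrib]
  refine Finset.sum_congr rfl fun k hk => ?_
  by_cases hki : k = i
  · subst hki
    simp only [Pi.add_apply, Pi.single_eq_same, Saturated, hk, true_and, if_true]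
    split_ifs <;> omega
  · simp [hki]

theorem hStarPrime_add_single_of_saturated {n g r : ℕ} {x : Fin r → ℤ} {i : Fin r}
    (h : Saturated n g x i) :
    hStarPrime n g r (x + Pi.single i 1) - hStarPrime n g r x = -1 := by
  unfold hStarPrime
  rw [excess_add_single, if_pos h, truncLast_add_single_of_saturated h]
  ring

theorem hStarPrime_add_single_of_not_saturated {n g r : ℕ} {x : Fin r → ℤ} {i : Fin r}
    (h : ¬ Saturated n g x i) :
    hStarPrime n g r (x + Pi.single i 1) - hStarPrime n g r x =
      hFun n g r (truncLast n g r x + Pi.single i 1) - hFun n g r (truncLast n g r x) := by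
  unfold hStarPrime
  rw [excess_add_single, if_neg h, truncLast_add_single_of_not_saturated h]
  ring

theorem Saturated.add_single {n g r : ℕ} {x : Fin r → ℤ} {j : Fin r}
    (h : Saturated n g x j) (i : Fin r) : Saturated n g (x + Pi.single i 1) j := by
  refine ⟨h.1, h.2.trans ?_⟩
  by_cases hij : j = i
  · subst hij; simp
  · simp [hij]

theorem hStarPrime_submodular (n g r : ℕ) (x : Fin r → ℤ) (i j : Fin r) :
    hStarPrime n g r (x + Pi.single i 1 + Pi.single j 1) - hStarPrime n g r (x + Pi.single i 1) ≤
      hStarPrime n g r (x + Pi.single j 1) - hStarPrime n g r x := by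
  by_cases hj : Saturated n g x j
  · rw [hStarPrime_add_single_of_saturated hj, hStarPrime_add_single_of_saturated (hj.add_single i)]
  · rw [hStarPrime_add_single_of_not_saturated hj]
    by_cases hj' : Saturated n g (x + Pi.single i 1) j
    · rw [hStarPrime_add_single_of_saturated hj']
      exact neg_one_le_hFun_marginal _ _ _ _ _
    · rw [hStarPrime_add_single_of_not_saturated hj']
      by_cases hi : Saturated n g x i
      · rw [truncLast_add_single_of_saturated hi]
      · rw [truncLast_add_single_of_not_saturated hi]
        exact hFun_submodular _ _ _ _ _ _

section induced
variable {U : Type*} [DecidableEq U]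

theorem isSubmodular_of_insert {f : Finset U → ℤ}
    (h : ∀ (A : Finset U) (b e : U), b ∉ A → e ∉ A → b ≠ e →
      f (insert e (insert b A)) - f (insert b A) ≤ f (insert e A) - f A) : IsSubmodular f := by
  intro A B e hAB heB
  obtain ⟨C, hC, rfl⟩ : ∃ C, Disjoint A C ∧ A ∪ C = B :=
    ⟨B \ A, Finset.disjoint_sdiff, Finset.union_sdiff_of_subset hAB⟩
  induction C using Finset.induction_on with
  | empty => simp
  | insert b C hb ih =>
    rw [Finset.disjoint_insert_right] at hC
    simp only [Finset.mem_union, Finset.mem_insert, not_or] at heB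
    rw [Finset.union_insert]
    refine (h (A ∪ C) b e ?_ ?_ ?_).trans (ih hC.2 Finset.subset_union_left ?_)
    · simp [hC.1, hb]
    · simp [heB.1, heB.2.2]
    · exact fun hbe => heB.2.1 hbe.symm
    · simp [heB.1, heB.2.2]

theorem inducedFn_insert {r : ℕ} {P : Fin r → Finset U}
    (hP : ∀ i j, i ≠ j → Disjoint (P i) (P j)) {j : Fin r} {e : U} (he : e ∈ P j)
    {A : Finset U} (heA : e ∉ A) (h : (Fin r → ℤ) → ℤ) :
    inducedFn P h (insert e A) = h ((fun i => ((A ∩ P i).card : ℤ)) + Pi.single j 1) := by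
  unfold inducedFn
  congr 1
  funext i
  by_cases hij : i = j
  · subst hij
    rw [Finset.insert_inter_of_mem he, Finset.card_insert_of_notMem (by simp [heA])]
    simp
  · rw [Finset.insert_inter_of_notMem]
    · simp [hij]
    · exact fun hi => Finset.disjoint_left.1 (hP i j hij) hi he

theorem inducedFn_insert_of_notMem {r : ℕ} {P : Fin r → Finset U} {e : U}
    (he : ∀ i, e ∉ P i) (A : Finset U) (h : (Fin r → ℤ) → ℤ) :
    inducedFn P h (insert e A) = inducedFn P h A := by
  unfold inducedFn
  congr 1
  funext i
  rw [Finset.insert_inter_of_notMem (he i)]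

theorem isSubmodular_inducedFn {r : ℕ} {P : Fin r → Finset U}
    (hP : ∀ i j, i ≠ j → Disjoint (P i) (P j)) {h : (Fin r → ℤ) → ℤ}
    (hh : ∀ (x : Fin r → ℤ) (i j : Fin r),
      h (x + Pi.single i 1 + Pi.single j 1) - h (x + Pi.single i 1) ≤ h (x + Pi.single j 1) - h x) :
    IsSubmodular (inducedFn P h) := by
  refine isSubmodular_of_insert fun A b e hb he hbe => ?_
  by_cases hej : ∃ j, e ∈ P j
  · obtain ⟨j, hj⟩ := hej
    have heb : e ∉ insert b A := by simp [he, hbe.symm]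
    by_cases hbi : ∃ i, b ∈ P i
    · obtain ⟨i, hi⟩ := hbi
      rw [inducedFn_insert hP hj heb, inducedFn_insert hP hj he, inducedFn_insert hP hi hb]
      have : (fun k => (((insert b A) ∩ P k).card : ℤ)) =
          (fun k => ((A ∩ P k).card : ℤ)) + Pi.single i 1 := by
        funext k
        by_cases hki : k = i
        · subst hki
          rw [Finset.insert_inter_of_mem hi, Finset.card_insert_of_notMem (by simp [hb])]
          simp
        · rw [Finset.insert_inter_of_notMem
            (fun hk => Finset.disjoint_left.1 (hP k i hki) hk hi)]
          simp [hki]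
      rw [this]
      exact hh _ i j
    · push Not at hbi
      rw [Finset.insert_comm, inducedFn_insert_of_notMem hbi, inducedFn_insert_of_notMem hbi]
  · push Not at hej
    rw [inducedFn_insert_of_notMem hej, inducedFn_insert_of_notMem hej, sub_self, sub_self]

end induced

theorem four_mul_mul_ediv (k r : ℕ) : ((4 * k : ℕ) : ℤ) * r / 4 = r * k := by
  push_cast
  rw [show (4 * k * r : ℤ) = 4 * (r * k) by ring]
  omega

section balanced
variable {n g r : ℕ}

theorem suffixFn_congr {i : Fin r} {x x' : Fin r → ℤ} (hx : ∀ j, j ≤ i → x j = x' j)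
    (hs : ∑ j, x j = ∑ j, x' j) {t : Fin r} (ht : (t : ℕ) ≤ i + 1) :
    suffixFn n g r t x = suffixFn n g r t x' := by
  have h : ∑ s, (x s - x' s) = 0 := by rw [Finset.sum_sub_distrib, hs, sub_self]
  have h2 : ∑ s, ((if t ≤ s then x s - ((n : ℤ) / 2 - g) else 0) -
      (if t ≤ s then x' s - ((n : ℤ) / 2 - g) else 0)) = 0 := by
    rw [← h]
    refine Finset.sum_congr rfl fun s _ => ?_
    split_ifs with hts
    · ring
    · rw [hx s, sub_self, sub_self]
      rw [Fin.le_def]; rw [Fin.le_def] at hts; omega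
  rw [Finset.sum_sub_distrib] at h2
  rw [suffixFn_eq, suffixFn_eq]
  omega

theorem suffixFn_le_of_le {x : Fin r → ℤ} {t u : Fin r} (hut : u ≤ t)
    (hx : ∀ s, u ≤ s → (n : ℤ) / 2 - g ≤ x s) : suffixFn n g r t x ≤ suffixFn n g r u x := by
  rw [suffixFn_eq, suffixFn_eq]
  gcongr with s
  split_ifs with h1 h2 h2
  · rfl
  · exact absurd (hut.trans h1) h2
  · linarith [hx s h2]
  · rfl

theorem suffixFn_nonpos (hg : 4 ∣ g) {x : Fin r → ℤ} {t : Fin r}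
    (hx : ∀ s, t ≤ s → 4 * (x s - ((n : ℤ) / 2 - g)) ≤ g) : suffixFn n g r t x ≤ 0 := by
  obtain ⟨k, rfl⟩ := hg
  rw [suffixFn_eq]
  have : (∑ s, if t ≤ s then x s - ((n : ℤ) / 2 - (4 * k : ℕ)) else 0) ≤ ∑ s : Fin r, (k : ℤ) := by
    refine Finset.sum_le_sum fun s _ => ?_
    split_ifs with h
    · have := hx s h
      push_cast at *
      omega
    · positivity
  rw [Finset.sum_const, Finset.card_univ, Fintype.card_fin, nsmul_eq_mul] at this
  rw [four_mul_mul_ediv]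
  linarith

theorem exists_filter_parity {i : Fin r} (hi : (i : ℕ) + 1 < r) {s : Finset (Fin r)}
    (hs : s = univ.filter (fun t : Fin r => Odd ((t : ℕ) + 1)) ∨
      s = univ.filter (fun t : Fin r => Even ((t : ℕ) + 1))) :
    ∃ u ∈ s, i ≤ u ∧ (u : ℕ) ≤ i + 1 := by
  rcases hs with rfl | rfl <;> rcases Nat.even_or_odd ((i : ℕ) + 1) with h | h
  · exact ⟨⟨i + 1, hi⟩, by simp [h.add_one], by simp [Fin.le_def], le_rfl⟩
  · exact ⟨i, by simpa using h, le_rfl, by omega⟩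
  · exact ⟨i, by simpa using h, le_rfl, by omega⟩
  · exact ⟨⟨i + 1, hi⟩, by simp [h.add_one], by simp [Fin.le_def], le_rfl⟩

theorem IsBalanced.eight_mul {i : Fin r} {x : Fin r → ℤ} (h : IsBalanced g i x) {j : Fin r}
    (hij : i ≤ j) : 8 * x i - g ≤ 8 * x j ∧ 8 * x j ≤ 8 * x i + g := by
  rcases hij.eq_or_lt with rfl | hij
  · omega
  · obtain ⟨h1, h2⟩ := h j hij
    have h1' : (8 * x i - g : ℝ) ≤ 8 * x j := by linarith
    have h2' : (8 * x j : ℝ) ≤ 8 * x i + g := by linarith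
    exact ⟨by exact_mod_cast h1', by exact_mod_cast h2'⟩

theorem maxWithZero_suffixFn_le_of_balanced (hg : 4 ∣ g) {i : Fin r} {x x' : Fin r → ℤ}
    (hb : IsBalanced g i x) (hx : ∀ j, j ≤ i → x j = x' j)
    (hs : ∑ j, x j = ∑ j, x' j) {s : Finset (Fin r)}
    (hpar : ∃ u ∈ s, i ≤ u ∧ (u : ℕ) ≤ i + 1) :
    maxWithZero s (fun t => suffixFn n g r t x) ≤ maxWithZero s (fun t => suffixFn n g r t x') := by
  refine maxWithZero_mono fun t ht => ?_
  by_cases hti : (t : ℕ) ≤ i + 1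
  · exact Or.inr ⟨t, ht, (suffixFn_congr hx hs hti).le⟩
  · by_cases hhi : 8 * ((n : ℤ) / 2 - g) + g ≤ 8 * x i
    · obtain ⟨u, hu, hiu, hui⟩ := hpar
      refine Or.inr ⟨u, hu, le_trans ?_ (suffixFn_congr hx hs hui).le⟩
      refine suffixFn_le_of_le (by rw [Fin.le_def]; omega) fun s hus => ?_
      have := hb.eight_mul (hiu.trans hus)
      omega
    · refine Or.inl (suffixFn_nonpos hg fun s hts => ?_)
      have := hb.eight_mul (j := s) (by rw [Fin.le_def] at *; omega)
      omega

/-- On balanced points, `h` only depends on the prefix and on the sum of the coordinates. -/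
theorem hFun_eq_of_balanced (hg : 4 ∣ g) {i : Fin r} (hi : (i : ℕ) + 1 < r) {x x' : Fin r → ℤ}
    (hb : IsBalanced g i x) (hb' : IsBalanced g i x') (hx : ∀ j, j ≤ i → x j = x' j)
    (hs : ∑ j, x j = ∑ j, x' j) : hFun n g r x = hFun n g r x' := by
  have key : ∀ s : Finset (Fin r), (∃ u ∈ s, i ≤ u ∧ (u : ℕ) ≤ i + 1) →
      maxWithZero s (fun t => suffixFn n g r t x) = maxWithZero s (fun t => suffixFn n g r t x') :=
    fun s hp => le_antisymm (maxWithZero_suffixFn_le_of_balanced hg hb hx hs hp)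
      (maxWithZero_suffixFn_le_of_balanced hg hb' (fun j hj => (hx j hj).symm) hs.symm hp)
  unfold hFun
  rw [hs, key _ (exists_filter_parity hi (Or.inl rfl)), key _ (exists_filter_parity hi (Or.inr rfl))]

/-- The amount by which truncation lowers a coordinate. -/
def excessLast (n g r : ℕ) (x : Fin r → ℤ) (s : Fin r) : ℤ := x s - truncLast n g r x s

theorem excessLast_eq (x : Fin r → ℤ) (s : Fin r) : excessLast n g r x s =
    if s ∈ lastThird r then max 0 (x s - ((n : ℤ) / 2 - (g : ℤ) / 4)) else 0 := by
  unfold excessLast truncLast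
  split_ifs <;> omega

theorem excessLast_nonneg (x : Fin r → ℤ) (s : Fin r) : 0 ≤ excessLast n g r x s := by
  rw [excessLast_eq]
  split_ifs <;> omega

theorem hStarPrime_eq (x : Fin r → ℤ) : hStarPrime n g r x =
    hFun n g r (truncLast n g r x) - ∑ s, excessLast n g r x s := by
  simp only [hStarPrime, excessLast_eq, Finset.sum_ite_mem, Finset.univ_inter]

theorem sum_truncLast (x : Fin r → ℤ) :
    ∑ s, truncLast n g r x s = ∑ s, x s - ∑ s, excessLast n g r x s := by
  simp [excessLast]

theorem suffixFn_truncLast {t : Fin r} (ht : ∀ s ∈ lastThird r, t ≤ s) (x : Fin r → ℤ) :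
    suffixFn n g r t (truncLast n g r x) = suffixFn n g r t x - ∑ s, excessLast n g r x s := by
  rw [suffixFn_eq, suffixFn_eq, sub_right_comm, ← Finset.sum_sub_distrib]
  congr 1
  refine Finset.sum_congr rfl fun s _ => ?_
  split_ifs with h
  · unfold excessLast; ring
  · rw [excessLast_eq, if_neg (fun hs => h (ht s hs)), sub_zero]

theorem maxWithZero_truncLast {s : Finset (Fin r)} (x : Fin r → ℤ) {i : Fin r}
    (hL : ∀ k ∈ lastThird r, (i : ℕ) + 1 ≤ k) (hpar : ∃ u ∈ s, i ≤ u ∧ (u : ℕ) ≤ i + 1)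
    (hx : ∀ k, i ≤ k → (n : ℤ) / 2 - g ≤ truncLast n g r x k)
    (hpos : ∀ u : Fin r, (u : ℕ) ≤ i + 1 → i ≤ u → 0 ≤ suffixFn n g r u (truncLast n g r x)) :
    maxWithZero s (fun t => suffixFn n g r t (truncLast n g r x)) =
      maxWithZero s (fun t => suffixFn n g r t x) - ∑ k, excessLast n g r x k := by
  obtain ⟨u, hu, hiu, hui⟩ := hpar
  have hD : 0 ≤ ∑ k, excessLast n g r x k := Finset.sum_nonneg fun k _ => excessLast_nonneg x k
  have htr : ∀ t : Fin r, (t : ℕ) ≤ i + 1 → _ := fun t ht => suffixFn_truncLast (n := n) (g := g)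
    (t := t) (fun k hk => by rw [Fin.le_def]; exact ht.trans (hL k hk)) x
  have hle : ∀ k, truncLast n g r x k ≤ x k := fun k => by
    have := excessLast_nonneg (n := n) (g := g) x k
    unfold excessLast at this; omega
  refine le_antisymm (maxWithZero_le_iff.2 ⟨?_, fun t ht => ?_⟩) ?_
  · have h1 := hpos u hui hiu
    have h2 := le_maxWithZero (fun t => suffixFn n g r t x) hu
    have h3 := htr u hui
    omega
  · by_cases hti : (t : ℕ) ≤ i + 1
    · have h2 := le_maxWithZero (fun t => suffixFn n g r t x) ht
      have h3 := htr t hti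
      omega
    · have h1 := suffixFn_le_of_le (n := n) (g := g) (x := truncLast n g r x) (t := t) (u := u)
        (by rw [Fin.le_def]; omega) (fun k hk => hx k (hiu.trans hk))
      have h2 := le_maxWithZero (fun t => suffixFn n g r t x) hu
      have h3 := htr u hui
      omega
  · rw [sub_le_iff_le_add]
    refine maxWithZero_le_iff.2 ⟨?_, fun t ht => ?_⟩
    · have := maxWithZero_nonneg s (fun t => suffixFn n g r t (truncLast n g r x))
      omega
    · by_cases hti : (t : ℕ) ≤ i + 1
      · have h2 := le_maxWithZero (fun t => suffixFn n g r t (truncLast n g r x)) ht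
        have h3 := htr t hti
        omega
      · have h1 := suffixFn_le_of_le (n := n) (g := g) (x := x) (t := t) (u := u)
          (by rw [Fin.le_def]; omega) (fun k hk => (hx k (hiu.trans hk)).trans (hle k))
        have h2 := le_maxWithZero (fun t => suffixFn n g r t (truncLast n g r x)) hu
        have h3 := htr u hui
        omega

/-- The modified function agrees with `h` on balanced points. -/
theorem hStarPrime_eq_hFun_of_balanced (hn : Even n) (hg : 4 ∣ g) {i : Fin r}
    (hi : 2 * ((i : ℕ) + 1) < r) {x : Fin r → ℤ} (hb : IsBalanced g i x) :
    hStarPrime n g r x = hFun n g r x := by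
  obtain ⟨m, rfl⟩ := hn
  obtain ⟨k, rfl⟩ := hg
  have hL : ∀ s ∈ lastThird r, (i : ℕ) + 1 ≤ s := fun s hs => by
    simp only [lastThird, Finset.mem_filter, Finset.mem_univ, true_and] at hs
    omega
  by_cases hlow : 2 * x i + 3 * k ≤ 2 * m
  · have htr : truncLast (m + m) (4 * k) r x = x := by
      funext s
      unfold truncLast
      split_ifs with hs
      · have := hb.eight_mul (j := s) (by have := hL s hs; rw [Fin.le_def]; omega)
        push_cast at *
        omega
      · rfl
    simp [hStarPrime_eq, excessLast, htr]
  · have hx : ∀ s, i ≤ s → (m : ℤ) - 2 * k ≤ truncLast (m + m) (4 * k) r x s := fun s hs => by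
      have := hb.eight_mul hs
      unfold truncLast
      push_cast at *
      split_ifs <;> omega
    have hpos : ∀ u : Fin r, (u : ℕ) ≤ i + 1 → i ≤ u →
        0 ≤ suffixFn (m + m) (4 * k) r u (truncLast (m + m) (4 * k) r x) := by
      intro u hui hiu
      have hcard : r ≤ 2 * (univ.filter fun s : Fin r => u ≤ s).card := by
        rw [Finset.filter_le_eq_Ici, Fin.card_Ici]
        omega
      have h1 : ∑ s ∈ univ.filter (fun s : Fin r => u ≤ s), (2 * k : ℤ) ≤
          ∑ s ∈ univ.filter (fun s : Fin r => u ≤ s),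
            (truncLast (m + m) (4 * k) r x s - (((m + m : ℕ) : ℤ) / 2 - (4 * k : ℕ))) := by
        refine Finset.sum_le_sum fun s hs => ?_
        have := hx s (hiu.trans (Finset.mem_filter.1 hs).2)
        push_cast at *
        omega
      rw [Finset.sum_const, nsmul_eq_mul] at h1
      have h5 : (r * k : ℤ) ≤ (2 * (univ.filter fun s : Fin r => u ≤ s).card) * k := by
        gcongr
        exact_mod_cast hcard
      unfold suffixFn
      rw [four_mul_mul_ediv]
      linarith
    have key : ∀ s : Finset (Fin r), (∃ u ∈ s, i ≤ u ∧ (u : ℕ) ≤ i + 1) → _ := fun s hp =>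
      maxWithZero_truncLast (n := m + m) (g := 4 * k) x hL hp
        (fun s hs => by have := hx s hs; push_cast at *; omega) hpos
    have hi' : (i : ℕ) + 1 < r := by omega
    rw [hStarPrime_eq]
    unfold hFun
    rw [sum_truncLast, key _ (exists_filter_parity hi' (Or.inl rfl)),
      key _ (exists_filter_parity hi' (Or.inr rfl))]
    ring

end balanced

section bounds
variable {n g r : ℕ}

theorem card_lastThird {k : ℕ} (hr : r = 3 * k) : (lastThird r).card = k := by
  subst hr
  rcases Nat.eq_zero_or_pos k with rfl | hk
  · rfl
  have : lastThird (3 * k) = Finset.Ici ⟨2 * k, by omega⟩ := by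
    ext s
    simp only [lastThird, Finset.mem_filter, Finset.mem_univ, true_and, Finset.mem_Ici, Fin.le_def]
    omega
  rw [this, Fin.card_Ici]
  simp only
  omega

/-- The four ways in which the two maxima in `h` can be attained. -/
theorem hFun_cases (n g r : ℕ) (x : Fin r → ℤ) :
    hFun n g r x = ∑ s, x s ∨
    (∃ a, hFun n g r x = ∑ s, x s - suffixFn n g r a x) ∨
    ∃ a b, a < b ∧ hFun n g r x = ∑ s, x s - (suffixFn n g r a x + suffixFn n g r b x) := by
  unfold hFun
  rcases maxWithZero_attained (univ.filter fun t : Fin r => Odd ((t : ℕ) + 1))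
      (fun t => suffixFn n g r t x) with ha | ⟨a, has, ha⟩ <;>
  rcases maxWithZero_attained (univ.filter fun t : Fin r => Even ((t : ℕ) + 1))
      (fun t => suffixFn n g r t x) with hb | ⟨b, hbs, hb⟩ <;> rw [ha, hb]
  · simp
  · exact Or.inr (Or.inl ⟨b, by rw [zero_add]⟩)
  · exact Or.inr (Or.inl ⟨a, by rw [add_zero]⟩)
  · refine Or.inr (Or.inr ?_)
    have hab : a ≠ b := by
      rintro rfl
      exact Nat.not_even_iff_odd.2 (Finset.mem_filter.1 has).2 (Finset.mem_filter.1 hbs).2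
    rcases lt_or_gt_of_ne hab with h | h
    · exact ⟨a, b, h, rfl⟩
    · exact ⟨b, a, h, by rw [add_comm]⟩

theorem hFun_le_sum (n g r : ℕ) (x : Fin r → ℤ) : hFun n g r x ≤ ∑ s, x s := by
  have h1 := maxWithZero_nonneg (univ.filter fun t : Fin r => Odd ((t : ℕ) + 1))
    (fun t => suffixFn n g r t x)
  have h2 := maxWithZero_nonneg (univ.filter fun t : Fin r => Even ((t : ℕ) + 1))
    (fun t => suffixFn n g r t x)
  unfold hFun
  omega

theorem hStarPrime_le_sum (n g r : ℕ) (x : Fin r → ℤ) : hStarPrime n g r x ≤ ∑ s, x s := by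
  have h1 := hFun_le_sum n g r (truncLast n g r x)
  have h2 := sum_truncLast (n := n) (g := g) x
  have hD : 0 ≤ ∑ k, excessLast n g r x k := Finset.sum_nonneg fun k _ => excessLast_nonneg x k
  rw [hStarPrime_eq]
  omega

theorem sum_const_fin (r : ℕ) (c : ℤ) : ∑ _s : Fin r, c = r * c := by simp

theorem sum_ite_eq_or (r : ℕ) (a : Fin r) (c d : ℤ) :
    ∑ s : Fin r, (if s = a then c else d) = r * d + (c - d) := by
  have : ∀ s : Fin r, (if s = a then c else d) = d + if s = a then c - d else 0 := fun s => by
    split_ifs <;> ring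
  simp [this, Finset.sum_add_distrib]

theorem hFun_nonneg (hn : Even n) (hg : 4 ∣ g) (hgr : 5 * g * r ≤ n) {x : Fin r → ℤ}
    (hx : InGrid n x) : 0 ≤ hFun n g r x := by
  rcases Nat.eq_zero_or_pos r with rfl | hr
  · simp [hFun, maxWithZero]
  obtain ⟨m, rfl⟩ := hn
  obtain ⟨k, rfl⟩ := hg
  have hkr : 10 * (k * r : ℤ) ≤ m := by
    have : 10 * (k * r) ≤ m := by linarith
    exact_mod_cast this
  have hk : (k : ℤ) ≤ k * r := by
    have : k * 1 ≤ k * r := Nat.mul_le_mul_left k hr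
    rw [mul_one] at this
    exact_mod_cast this
  rcases hFun_cases (m + m) (4 * k) r x with h | ⟨a, h⟩ | ⟨a, b, hab, h⟩ <;> rw [h]
  · exact Finset.sum_nonneg fun s _ => (hx s).1
  · rw [suffixFn_eq, four_mul_mul_ediv, sub_sub_eq_add_sub, add_sub_right_comm,
      ← Finset.sum_sub_distrib]
    refine add_nonneg (Finset.sum_nonneg fun s _ => ?_) (by positivity)
    have := hx s
    push_cast
    split_ifs <;> omega
  · have key : ∑ s, (if s = a then (m - 4 * k : ℤ) else - (8 * k)) ≤
        ∑ s, (x s - ((if a ≤ s then x s - (((m + m : ℕ) : ℤ) / 2 - (4 * k : ℕ)) else 0) +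
          (if b ≤ s then x s - (((m + m : ℕ) : ℤ) / 2 - (4 * k : ℕ)) else 0))) := by
      refine Finset.sum_le_sum fun s _ => ?_
      have := hx s
      push_cast at *
      by_cases hsa : s = a
      · subst hsa
        rw [if_pos rfl, if_pos le_rfl, if_neg (not_le.2 hab)]
        omega
      · rw [if_neg hsa]
        split_ifs <;> omega
    rw [sum_ite_eq_or, Finset.sum_sub_distrib, Finset.sum_add_distrib] at key
    rw [suffixFn_eq, suffixFn_eq, four_mul_mul_ediv]
    linarith

theorem neg_gap_le_hStarPrime (hn : Even n) (hg : 4 ∣ g) (h3 : 3 ∣ r) (hgr : 5 * g * r ≤ n)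
    {x : Fin r → ℤ} (hx : InGrid n x) : -((g : ℤ) * r) ≤ 6 * hStarPrime n g r x := by
  rcases Nat.eq_zero_or_pos r with rfl | hr
  · simp [hFun, maxWithZero, hStarPrime_eq]
  obtain ⟨m, rfl⟩ := hn
  obtain ⟨k, rfl⟩ := hg
  obtain ⟨q, hrq⟩ := h3
  have hkr : 10 * (k * r : ℤ) ≤ m := by
    have : 10 * (k * r) ≤ m := by linarith
    exact_mod_cast this
  have hk : (k : ℤ) ≤ k * r := by
    have : k * 1 ≤ k * r := Nat.mul_le_mul_left k hr
    rw [mul_one] at this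
    exact_mod_cast this
  have hLsum : ∀ c : ℤ, ∑ s : Fin r, (if s ∈ lastThird r then c else 0) = q * c := fun c => by
    rw [Finset.sum_ite_mem, Finset.univ_inter, Finset.sum_const, card_lastThird hrq,
      nsmul_eq_mul]
  have hq : (r : ℤ) = 3 * q := by rw [hrq]; push_cast; rfl
  have hD := fun s => excessLast_eq (n := m + m) (g := 4 * k) x s
  have hy : ∀ s, truncLast (m + m) (4 * k) r x s = x s - excessLast (m + m) (4 * k) r x s :=
    fun s => by unfold excessLast; ring
  rw [hStarPrime_eq]
  rcases hFun_cases (m + m) (4 * k) r (truncLast (m + m) (4 * k) r x) with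
    h | ⟨a, h⟩ | ⟨a, b, hab, h⟩ <;> rw [h]
  · have key : ∑ s, (if s ∈ lastThird r then (-(2 * k) : ℤ) else 0) ≤
        ∑ s, (truncLast (m + m) (4 * k) r x s - excessLast (m + m) (4 * k) r x s) := by
      refine Finset.sum_le_sum fun s _ => ?_
      have h1 := hx s
      rw [hy s, hD s]
      push_cast at *
      split_ifs <;> omega
    rw [hLsum, Finset.sum_sub_distrib] at key
    push_cast at *
    rw [hq]
    linarith
  · rw [suffixFn_eq, four_mul_mul_ediv]
    have key : ∑ s, (if s ∈ lastThird r then (-(5 * k) : ℤ) else 0) ≤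
        ∑ s, (truncLast (m + m) (4 * k) r x s -
          (if a ≤ s then truncLast (m + m) (4 * k) r x s -
            (((m + m : ℕ) : ℤ) / 2 - (4 * k : ℕ)) else 0) -
          excessLast (m + m) (4 * k) r x s) := by
      refine Finset.sum_le_sum fun s _ => ?_
      have h1 := hx s
      rw [hy s, hD s]
      push_cast at *
      split_ifs <;> omega
    rw [hLsum, Finset.sum_sub_distrib, Finset.sum_sub_distrib] at key
    push_cast at *
    rw [hq]
    linarith
  · rw [suffixFn_eq, suffixFn_eq, four_mul_mul_ediv]
    by_cases haL : a ∈ lastThird r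
    · have key : ∑ s, (if s ∈ lastThird r then (-(8 * k) : ℤ) else 0) ≤
          ∑ s, (truncLast (m + m) (4 * k) r x s -
            ((if a ≤ s then truncLast (m + m) (4 * k) r x s -
              (((m + m : ℕ) : ℤ) / 2 - (4 * k : ℕ)) else 0) +
            (if b ≤ s then truncLast (m + m) (4 * k) r x s -
              (((m + m : ℕ) : ℤ) / 2 - (4 * k : ℕ)) else 0)) -
            excessLast (m + m) (4 * k) r x s) := by
        refine Finset.sum_le_sum fun s _ => ?_
        have h1 := hx s
        rw [hy s, hD s]
        by_cases hs : s ∈ lastThird r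
        · simp only [if_pos hs]
          push_cast at *
          split_ifs <;> omega
        · have hsa : ¬ a ≤ s := fun has => by
            simp only [lastThird, Finset.mem_filter, Finset.mem_univ, true_and] at hs haL
            rw [Fin.le_def] at has
            omega
          have hsb : ¬ b ≤ s := fun hbs => hsa (hab.le.trans hbs)
          simp only [if_neg hs, if_neg hsa, if_neg hsb]
          omega
      rw [hLsum, Finset.sum_sub_distrib, Finset.sum_sub_distrib, Finset.sum_add_distrib] at key
      push_cast at *
      rw [hq]
      linarith
    · have key : ∑ s, (if s = a then (m - 4 * k : ℤ) else - (8 * k)) ≤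
          ∑ s, (truncLast (m + m) (4 * k) r x s -
            ((if a ≤ s then truncLast (m + m) (4 * k) r x s -
              (((m + m : ℕ) : ℤ) / 2 - (4 * k : ℕ)) else 0) +
            (if b ≤ s then truncLast (m + m) (4 * k) r x s -
              (((m + m : ℕ) : ℤ) / 2 - (4 * k : ℕ)) else 0)) -
            excessLast (m + m) (4 * k) r x s) := by
        refine Finset.sum_le_sum fun s _ => ?_
        have h1 := hx s
        rw [hy s, hD s]
        by_cases hsa : s = a
        · subst hsa
          rw [if_pos rfl, if_pos le_rfl, if_neg (not_le.2 hab), if_neg haL]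
          push_cast at *
          omega
        · rw [if_neg hsa]
          push_cast at *
          split_ifs <;> omega
      rw [sum_ite_eq_or, Finset.sum_sub_distrib, Finset.sum_sub_distrib,
        Finset.sum_add_distrib] at key
      push_cast at *
      linarith

theorem hFun_eq_sum_of_suffixFn_nonpos {x : Fin r → ℤ} (h : ∀ t, suffixFn n g r t x ≤ 0) :
    hFun n g r x = ∑ s, x s := by
  have : ∀ s : Finset (Fin r), maxWithZero s (fun t => suffixFn n g r t x) = 0 := fun s =>
    le_antisymm (maxWithZero_le_iff.2 ⟨le_rfl, fun t _ => h t⟩) (maxWithZero_nonneg _ _)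
  simp [hFun, this]

theorem hFun_zero (hg : 4 ∣ g) (hgr : 5 * g * r ≤ n) :
    hFun n g r (fun _ => 0) = 0 := by
  rcases Nat.eq_zero_or_pos r with rfl | hr
  · simp [hFun, maxWithZero]
  rw [hFun_eq_sum_of_suffixFn_nonpos, Finset.sum_const_zero]
  refine fun t => suffixFn_nonpos hg fun s _ => ?_
  have : 5 * g * 1 ≤ 5 * g * r := Nat.mul_le_mul_left _ hr
  omega

/-- The value of the modified function at the union of the last third of the parts. -/
theorem hStarPrime_lastThird (hn : Even n) (hg : 4 ∣ g) (h3 : 3 ∣ r) (hgr : 5 * g * r ≤ n) :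
    6 * hStarPrime n g r (fun i => if i ∈ lastThird r then (n : ℤ) else 0) = -((g : ℤ) * r) := by
  rcases Nat.eq_zero_or_pos r with rfl | hr
  · simp [hFun, maxWithZero, hStarPrime_eq]
  obtain ⟨m, rfl⟩ := hn
  obtain ⟨k, rfl⟩ := hg
  obtain ⟨q, hrq⟩ := h3
  have hk : 10 * (k : ℤ) ≤ m := by
    have : 5 * (4 * k) * 1 ≤ 5 * (4 * k) * r := Nat.mul_le_mul_left _ hr
    omega
  have hLsum : ∀ c : ℤ, ∑ s : Fin r, (if s ∈ lastThird r then c else 0) = q * c := fun c => by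
    rw [Finset.sum_ite_mem, Finset.univ_inter, Finset.sum_const, card_lastThird hrq,
      nsmul_eq_mul]
  have hq : (r : ℤ) = 3 * q := by rw [hrq]; push_cast; rfl
  have hy : truncLast (m + m) (4 * k) r
      (fun i => if i ∈ lastThird r then ((m + m : ℕ) : ℤ) else 0) =
      fun i => if i ∈ lastThird r then (m - k : ℤ) else 0 := by
    funext s
    unfold truncLast
    push_cast
    split_ifs <;> omega
  have hD : ∀ s, excessLast (m + m) (4 * k) r
      (fun i => if i ∈ lastThird r then ((m + m : ℕ) : ℤ) else 0) s =
      if s ∈ lastThird r then (m + k : ℤ) else 0 := fun s => by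
    unfold excessLast
    rw [hy]
    push_cast
    split_ifs <;> omega
  rw [hStarPrime_eq, Finset.sum_congr rfl fun s _ => hD s, hy, hFun_eq_sum_of_suffixFn_nonpos]
  · rw [hLsum, hLsum]
    push_cast
    rw [hq]
    ring
  · intro t
    rw [suffixFn_eq, four_mul_mul_ediv]
    have key : (∑ s, if t ≤ s then (if s ∈ lastThird r then (m - k : ℤ) else 0) -
        (((m + m : ℕ) : ℤ) / 2 - (4 * k : ℕ)) else 0) ≤
        ∑ s, if s ∈ lastThird r then (3 * k : ℤ) else 0 := by
      refine Finset.sum_le_sum fun s _ => ?_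
      push_cast
      split_ifs <;> omega
    rw [hLsum] at key
    rw [hq]
    linarith

end bounds

theorem inducedFn_biUnion {U : Type*} [DecidableEq U] {n r : ℕ} {P : Fin r → Finset U}
    (hc : ∀ i, (P i).card = n) (hP : ∀ i j, i ≠ j → Disjoint (P i) (P j)) (L : Finset (Fin r))
    (h : (Fin r → ℤ) → ℤ) :
    inducedFn P h (L.biUnion P) = h fun i => if i ∈ L then (n : ℤ) else 0 := by
  unfold inducedFn
  congr 1
  funext i
  split_ifs with hi
  · rw [Finset.inter_eq_right.2 (Finset.subset_biUnion_of_mem P hi), hc]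
  · rw [Nat.cast_eq_zero, Finset.card_eq_zero, ← Finset.disjoint_iff_inter_eq_empty,
      Finset.disjoint_biUnion_left]
    exact fun j hj => hP j i fun hji => hi (hji ▸ hj)

/-- The properties of the modified function. -/
theorem hStarPrime_properties (n g r : ℕ) (hn : Even n) (hg : 4 ∣ g) (h3 : 3 ∣ r) :
    IsGridSubmodular n (hStarPrime n g r) ∧
      (∀ (i : Fin r) (x x' : Fin r → ℤ), ((i : ℕ) + 1 : ℝ) < (r : ℝ) / 2 →
        InGrid n x → InGrid n x' → IsBalanced g i x → IsBalanced g i x' →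
        (∀ j, j ≤ i → x j = x' j) → ∑ j, x j = ∑ j, x' j →
        hStarPrime n g r x = hStarPrime n g r x' ∧ hStarPrime n g r x' = hFun n g r x ∧
          hFun n g r x = hFun n g r x') ∧
      (∀ (U : Type) [Fintype U] [DecidableEq U] (P : Fin r → Finset U), IsEquipartition n P →
        IsSubmodular (inducedFn P (hStarPrime n g r)) ∧
        (5 * g * r ≤ n →
          (inducedFn P (hFun n g r) ∅ = 0 ∧ ∀ S, 0 ≤ inducedFn P (hFun n g r) S) ∧
          ((inducedFn P (hStarPrime n g r) ((lastThird r).biUnion P) : ℝ) = -((g : ℝ) * r / 6) ∧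
            ∀ S, inducedFn P (hStarPrime n g r) ((lastThird r).biUnion P) ≤
              inducedFn P (hStarPrime n g r) S))) := by
  refine ⟨fun x i j _ _ => hStarPrime_submodular n g r x i j, ?_, fun U _ _ P hP => ⟨?_, ?_⟩⟩
  · intro i x x' hi _ _ hb hb' hx hs
    have hi2 : 2 * ((i : ℕ) + 1) < r := by
      have : (2 * ((i : ℕ) + 1) : ℝ) < r := by linarith
      exact_mod_cast this
    have h1 := hFun_eq_of_balanced (n := n) hg (by omega) hb hb' hx hs
    have h2 := hStarPrime_eq_hFun_of_balanced hn hg hi2 hb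
    have h3 := hStarPrime_eq_hFun_of_balanced hn hg hi2 hb'
    exact ⟨by rw [h2, h1, h3], by rw [h3, h1], h1⟩
  · exact isSubmodular_inducedFn hP.2.1 (hStarPrime_submodular n g r)
  · intro hgr
    have hgrid : ∀ S : Finset U, InGrid n fun i => ((S ∩ P i).card : ℤ) := fun S i => by
      have := Finset.card_le_card (Finset.inter_subset_right (s₁ := S) (s₂ := P i))
      rw [hP.1 i] at this
      exact ⟨Nat.cast_nonneg _, Nat.cast_le.2 this⟩
    have hval := hStarPrime_lastThird hn hg h3 hgr
    rw [← inducedFn_biUnion hP.1 hP.2.1 _ (hStarPrime n g r)] at hval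
    refine ⟨⟨?_, fun S => hFun_nonneg hn hg hgr (hgrid S)⟩, ?_, fun S => ?_⟩
    · simpa [inducedFn] using hFun_zero hg hgr
    · have : (6 * inducedFn P (hStarPrime n g r) ((lastThird r).biUnion P) : ℝ) = -(g * r) := by
        exact_mod_cast hval
      linarith
    · have := neg_gap_le_hStarPrime hn hg h3 hgr (hgrid S)
      unfold inducedFn at *
      omega

/-- Bounds between `n ^ 3` and `N ^ 2 (c log N)` in the parameter regime of the construction. -/
theorem gap_bounds {c : ℝ} {n g r : ℕ} (hc : 1 ≤ c)
    (h1 : 200 * Real.sqrt (c * n * Real.log n) ≤ g)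
    (h2 : (g : ℝ) ≤ 800 * Real.sqrt (c * n * Real.log n))
    (hr : IsGreatest {r' : ℕ | Odd r' ∧ 3 ∣ r' ∧ 5 * g * r' ≤ n} r) :
    (n : ℝ) ≤ 15 * (g * r) ∧ 5 * (g * r : ℝ) ≤ n ∧
      ((n * r : ℕ) : ℝ) ^ 2 * (c * Real.log (n * r : ℕ)) ≤ (n : ℝ) ^ 3 ∧
      (n : ℝ) ^ 3 ≤ (12000 : ℝ) ^ 2 * (((n * r : ℕ) : ℝ) ^ 2 * (c * Real.log (n * r : ℕ))) := by
  obtain ⟨⟨hodd, h3, hgr⟩, hmax⟩ := hr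
  have hr3 : 3 ≤ r := Nat.le_of_dvd hodd.pos h3
  have hnext : n < 5 * g * (r + 6) := by
    by_contra! hcon
    have : r + 6 ≤ r := hmax ⟨by rw [Nat.odd_add]; simp [hodd]; decide, by omega, hcon⟩
    omega
  have hg0 : 0 < g := by
    rcases Nat.eq_zero_or_pos g with rfl | h
    · simp at hnext
    · exact h
  have hn15 : 15 * g ≤ n := by
    calc 15 * g = 5 * g * 3 := by ring
      _ ≤ 5 * g * r := Nat.mul_le_mul_left _ hr3
      _ ≤ n := hgr
  have hup : n ≤ 15 * (g * r) := by
    calc n ≤ 5 * g * (r + 6) := hnext.le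
      _ ≤ 5 * g * (3 * r) := Nat.mul_le_mul_left _ (by omega)
      _ = 15 * (g * r) := by ring
  have hn1 : (15 : ℝ) ≤ n := by
    have : 15 ≤ n := by omega
    exact_mod_cast this
  have hrn : r ≤ n := by
    calc r = 1 * r := by ring
      _ ≤ 5 * g * r := Nat.mul_le_mul_right _ (by omega)
      _ ≤ n := hgr
  have hupR : (n : ℝ) ≤ 15 * (g * r) := by exact_mod_cast hup
  have hloR : 5 * (g * r : ℝ) ≤ n := by
    have : 5 * (g * r) ≤ n := by linarith
    exact_mod_cast this
  have hlog : 0 < Real.log n := Real.log_pos (by linarith)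
  have hr1 : (1 : ℝ) ≤ r := by
    have : 1 ≤ r := by omega
    exact_mod_cast this
  have hrnR : (r : ℝ) ≤ n := by exact_mod_cast hrn
  have hlogN : Real.log (n * r : ℕ) = Real.log n + Real.log r := by
    push_cast
    rw [Real.log_mul (by positivity) (by positivity)]
  have hlogr : 0 ≤ Real.log r := Real.log_nonneg hr1
  have hlogr' : Real.log r ≤ Real.log n := Real.log_le_log (by linarith) hrnR
  set q := c * n * Real.log n with hq
  have hq0 : 0 < q := by positivity
  have hsq : Real.sqrt q ^ 2 = q := Real.sq_sqrt hq0.le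
  have hg1 : 40000 * q ≤ (g : ℝ) ^ 2 := by
    calc 40000 * q = (200 * Real.sqrt q) ^ 2 := by rw [mul_pow, hsq]; norm_num
      _ ≤ (g : ℝ) ^ 2 := by gcongr
  have hg2 : (g : ℝ) ^ 2 ≤ 640000 * q := by
    calc (g : ℝ) ^ 2 ≤ (800 * Real.sqrt q) ^ 2 := by gcongr
      _ = 640000 * q := by rw [mul_pow, hsq]; norm_num
  refine ⟨hupR, hloR, ?_, ?_⟩
  · rw [hlogN]
    have e1 : (g : ℝ) ^ 2 * (r : ℝ) ^ 2 ≤ (n : ℝ) ^ 2 := by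
      calc (g : ℝ) ^ 2 * (r : ℝ) ^ 2 = ((g : ℝ) * r) ^ 2 := by ring
        _ ≤ (n : ℝ) ^ 2 := by gcongr; nlinarith [show (0 : ℝ) ≤ g * r by positivity]
    have e2 : 40000 * q * r ^ 2 ≤ n ^ 2 := le_trans (by gcongr) e1
    have e3 : 40000 * (c * Real.log n * r ^ 2) ≤ n := by
      have : 40000 * (c * Real.log n * r ^ 2) * n ≤ n * n := by rw [hq] at e2; linarith
      exact le_of_mul_le_mul_right this (by linarith)
    push_cast
    calc (n * r : ℝ) ^ 2 * (c * (Real.log n + Real.log r))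
        ≤ (n * r : ℝ) ^ 2 * (c * (Real.log n + Real.log n)) := by gcongr
      _ = n ^ 2 * (2 * (c * Real.log n * r ^ 2)) := by ring
      _ ≤ n ^ 2 * n := by
        gcongr
        have : 0 ≤ c * Real.log n * r ^ 2 := by positivity
        linarith
      _ = n ^ 3 := by ring
  · rw [hlogN]
    have e1 : (n : ℝ) ^ 2 ≤ 225 * ((g : ℝ) ^ 2 * (r : ℝ) ^ 2) := by
      calc (n : ℝ) ^ 2 ≤ (15 * ((g : ℝ) * r)) ^ 2 := by gcongr
        _ = 225 * ((g : ℝ) ^ 2 * (r : ℝ) ^ 2) := by ring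
    have e2 : (n : ℝ) ^ 2 ≤ 225 * (640000 * q * r ^ 2) := e1.trans (by gcongr)
    push_cast
    calc (n : ℝ) ^ 3 = n * n ^ 2 := by ring
      _ ≤ n * (225 * (640000 * q * r ^ 2)) := by gcongr
      _ = 12000 ^ 2 * ((n * r : ℝ) ^ 2 * (c * (Real.log n + 0))) := by rw [hq]; ring
      _ ≤ _ := by gcongr

theorem rpow_two_thirds_mul {a b : ℝ} (ha : 0 ≤ a) (hb : 0 ≤ b) :
    a ^ (2 / 3 : ℝ) * b ^ (1 / 3 : ℝ) = (a ^ 2 * b) ^ (1 / 3 : ℝ) := by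
  rw [Real.mul_rpow (by positivity) hb, ← Real.rpow_natCast a 2, ← Real.rpow_mul ha]
  norm_num

theorem cube_rpow_third {a : ℝ} (ha : 0 ≤ a) : (a ^ 3) ^ (1 / 3 : ℝ) = a := by
  rw [← Real.rpow_natCast a 3, ← Real.rpow_mul ha]
  norm_num

/-- The order of magnitude of the gap. -/
theorem gap_order : ∃ C₁ C₂ : ℝ, 0 < C₁ ∧ 0 < C₂ ∧ ∀ (c : ℝ) (n g r : ℕ), 1 ≤ c → Even n → 4 ∣ g →
      200 * Real.sqrt (c * n * Real.log n) ≤ g → (g : ℝ) ≤ 800 * Real.sqrt (c * n * Real.log n) →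
      IsGreatest {r' : ℕ | Odd r' ∧ 3 ∣ r' ∧ 5 * g * r' ≤ n} r →
      C₁ * (((n * r : ℕ) : ℝ) ^ (2 / 3 : ℝ) * (c * Real.log (n * r : ℕ)) ^ (1 / 3 : ℝ)) ≤
          (g : ℝ) * r / 6 ∧
        (g : ℝ) * r / 6 ≤
          C₂ * (((n * r : ℕ) : ℝ) ^ (2 / 3 : ℝ) * (c * Real.log (n * r : ℕ)) ^ (1 / 3 : ℝ)) := by
  refine ⟨1 / 90, 1000, by norm_num, by norm_num, fun c n g r hc _ _ h1 h2 hr => ?_⟩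
  obtain ⟨b1, b2, b3, b4⟩ := gap_bounds hc h1 h2 hr
  have hlog : 0 ≤ c * Real.log (n * r : ℕ) := mul_nonneg (by linarith) (Real.log_natCast_nonneg _)
  rw [rpow_two_thirds_mul (Nat.cast_nonneg _) hlog]
  set X := ((n * r : ℕ) : ℝ) ^ 2 * (c * Real.log (n * r : ℕ)) with hX
  have hX0 : 0 ≤ X := by positivity
  have e1 : X ^ (1 / 3 : ℝ) ≤ n := by
    rw [← cube_rpow_third (Nat.cast_nonneg n)]
    exact Real.rpow_le_rpow hX0 b3 (by norm_num)
  have e2 : (n : ℝ) ≤ 1000 * X ^ (1 / 3 : ℝ) := by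
    rw [← cube_rpow_third (Nat.cast_nonneg n), ← cube_rpow_third (show (0 : ℝ) ≤ 1000 by norm_num),
      ← Real.mul_rpow (by positivity) hX0]
    refine Real.rpow_le_rpow (by positivity) (b4.trans ?_) (by norm_num)
    gcongr
    norm_num
  have : 0 ≤ X ^ (1 / 3 : ℝ) := by positivity
  constructor <;> linarith

section concentration
variable {V β : Type*} [DecidableEq V] [DecidableEq β] {F : Finset (V → β)} {R : Finset V}
  {c : β} {n : ℕ}

/-- In a family of colourings that is symmetric under permutations of `R`, the events that given
points of `R` receive the colour `c` are negatively correlated. -/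
theorem card_filter_forall_le (hF : ∀ a ∈ R, ∀ b ∈ R, ∀ χ ∈ F, χ ∘ Equiv.swap a b ∈ F)
    (hc : ∀ χ ∈ F, (R.filter fun v => χ v = c).card = n) {T : Finset V} (hT : T ⊆ R) :
    ((F.filter fun χ => ∀ v ∈ T, χ v = c).card : ℝ) ≤ ((n : ℝ) / R.card) ^ T.card * F.card := by
  induction T using Finset.induction_on with
  | empty => simp
  | insert v T hv ih =>
    obtain ⟨hvR, hTR⟩ := Finset.insert_subset_iff.1 hT
    rcases (F.filter fun χ => ∀ v ∈ T, χ v = c).eq_empty_or_nonempty with hempty | ⟨χ₀, hχ₀⟩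
    · have : (F.filter fun χ => ∀ u ∈ insert v T, χ u = c) = ∅ := by
        rw [← Finset.subset_empty, ← hempty]
        exact Finset.monotone_filter_right _ fun χ _ hχ u hu => hχ u (Finset.mem_insert_of_mem hu)
      rw [this]
      simp only [Finset.card_empty, Nat.cast_zero]
      positivity
    have hTsub : ∀ χ ∈ F.filter (fun χ => ∀ v ∈ T, χ v = c),
        T ⊆ R.filter fun v => χ v = c := fun χ hχ u hu =>
      Finset.mem_filter.2 ⟨hTR hu, (Finset.mem_filter.1 hχ).2 u hu⟩
    have hTn : T.card ≤ n := by
      rw [← hc χ₀ (Finset.mem_filter.1 hχ₀).1]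
      exact Finset.card_le_card (hTsub χ₀ hχ₀)
    have hnR : n ≤ R.card := by
      rw [← hc χ₀ (Finset.mem_filter.1 hχ₀).1]
      exact Finset.card_filter_le _ _
    have hTlt : T.card < R.card := by
      have := Finset.card_le_card hT
      rw [Finset.card_insert_of_notMem hv] at this
      omega
    have hsym : ∀ w ∈ R \ T, (F.filter fun χ => ∀ u ∈ insert w T, χ u = c).card =
        (F.filter fun χ => ∀ u ∈ insert v T, χ u = c).card := by
      intro w hw
      obtain ⟨hwR, hwT⟩ := Finset.mem_sdiff.1 hw
      have hfix : ∀ u ∈ T, Equiv.swap v w u = u := fun u hu =>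
        Equiv.swap_apply_of_ne_of_ne (fun h => hv (h ▸ hu)) (fun h => hwT (h ▸ hu))
      refine Finset.card_bij' (fun χ _ => χ ∘ Equiv.swap v w) (fun χ _ => χ ∘ Equiv.swap v w)
        ?_ ?_ ?_ ?_
      · intro χ hχ
        simp only [Finset.mem_filter, Finset.forall_mem_insert] at hχ ⊢
        refine ⟨hF v hvR w hwR χ hχ.1, by simpa using hχ.2.1, fun u hu => ?_⟩
        rw [Function.comp_apply, hfix u hu]
        exact hχ.2.2 u hu
      · intro χ hχ
        simp only [Finset.mem_filter, Finset.forall_mem_insert] at hχ ⊢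
        refine ⟨hF v hvR w hwR χ hχ.1, by simpa using hχ.2.1, fun u hu => ?_⟩
        rw [Function.comp_apply, hfix u hu]
        exact hχ.2.2 u hu
      · intro χ _
        funext u
        simp
      · intro χ _
        funext u
        simp
    have hdouble : (R.card - T.card) * (F.filter fun χ => ∀ u ∈ insert v T, χ u = c).card =
        (n - T.card) * (F.filter fun χ => ∀ u ∈ T, χ u = c).card := by
      calc (R.card - T.card) * (F.filter fun χ => ∀ u ∈ insert v T, χ u = c).card
          = ∑ w ∈ R \ T, (F.filter fun χ => ∀ u ∈ insert w T, χ u = c).card := by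
            rw [Finset.sum_congr rfl hsym, Finset.sum_const, smul_eq_mul,
              Finset.card_sdiff_of_subset hTR]
        _ = ∑ w ∈ R \ T, ((F.filter fun χ => ∀ u ∈ T, χ u = c).filter fun χ => χ w = c).card := by
            refine Finset.sum_congr rfl fun w _ => congrArg _ ?_
            rw [Finset.filter_filter]
            refine Finset.filter_congr fun χ _ => ?_
            rw [Finset.forall_mem_insert, and_comm]
        _ = ∑ χ ∈ F.filter fun χ => ∀ u ∈ T, χ u = c, ((R \ T).filter fun w => χ w = c).card :=
            Finset.sum_card_bipartiteAbove_eq_sum_card_bipartiteBelow _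
        _ = ∑ χ ∈ F.filter fun χ => ∀ u ∈ T, χ u = c, (n - T.card) := by
            refine Finset.sum_congr rfl fun χ hχ => ?_
            have : ((R \ T).filter fun w => χ w = c) = (R.filter fun w => χ w = c) \ T := by
              ext w; simp only [Finset.mem_filter, Finset.mem_sdiff]; tauto
            rw [this, Finset.card_sdiff_of_subset (hTsub χ hχ), hc χ (Finset.mem_filter.1 hχ).1]
        _ = _ := by rw [Finset.sum_const, smul_eq_mul, mul_comm]
    have hR0 : (0 : ℝ) < R.card := by
      have : 0 < R.card := by omega
      exact_mod_cast this
    have hdR : ((R.card : ℝ) - T.card) * (F.filter fun χ => ∀ u ∈ insert v T, χ u = c).card =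
        ((n : ℝ) - T.card) * (F.filter fun χ => ∀ u ∈ T, χ u = c).card := by
      have := congrArg (Nat.cast : ℕ → ℝ) hdouble
      rw [Nat.cast_mul, Nat.cast_mul, Nat.cast_sub hTlt.le, Nat.cast_sub hTn] at this
      exact this
    have hpos : (0 : ℝ) < (R.card : ℝ) - T.card := by
      rw [sub_pos]; exact_mod_cast hTlt
    have hratio : ((n : ℝ) - T.card) ≤ (n : ℝ) / R.card * ((R.card : ℝ) - T.card) := by
      have h1 : (n : ℝ) / R.card ≤ 1 := by
        rw [div_le_one hR0]; exact_mod_cast hnR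
      have h2 : (n : ℝ) / R.card * T.card ≤ 1 * T.card := by gcongr
      rw [mul_sub, div_mul_cancel₀ _ hR0.ne']
      linarith
    have hstep : ((F.filter fun χ => ∀ u ∈ insert v T, χ u = c).card : ℝ) ≤
        (n : ℝ) / R.card * (F.filter fun χ => ∀ u ∈ T, χ u = c).card := by
      refine le_of_mul_le_mul_left ?_ hpos
      rw [hdR]
      calc ((n : ℝ) - T.card) * (F.filter fun χ => ∀ u ∈ T, χ u = c).card
          ≤ ((n : ℝ) / R.card * ((R.card : ℝ) - T.card)) *
            (F.filter fun χ => ∀ u ∈ T, χ u = c).card := by gcongr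
        _ = _ := by ring
    rw [Finset.card_insert_of_notMem hv, pow_succ']
    calc ((F.filter fun χ => ∀ u ∈ insert v T, χ u = c).card : ℝ)
        ≤ (n : ℝ) / R.card * (F.filter fun χ => ∀ u ∈ T, χ u = c).card := hstep
      _ ≤ (n : ℝ) / R.card * (((n : ℝ) / R.card) ^ T.card * F.card) := by
          gcongr
          exact ih hTR
      _ = _ := by ring

theorem sum_pow_card_filter_le (hF : ∀ a ∈ R, ∀ b ∈ R, ∀ χ ∈ F, χ ∘ Equiv.swap a b ∈ F)
    (hc : ∀ χ ∈ F, (R.filter fun v => χ v = c).card = n) {S : Finset V} (hS : S ⊆ R) {z : ℝ}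
    (hz : 0 ≤ z) :
    ∑ χ ∈ F, (1 + z) ^ (S.filter fun v => χ v = c).card ≤
      F.card * Real.exp (z * (n * S.card / R.card)) := by
  have hexp : ∀ (A : Finset V) (y : ℝ), (1 + y) ^ A.card = ∑ T ∈ A.powerset, y ^ T.card := by
    intro A y
    rw [← Finset.prod_const, Finset.prod_one_add]
    simp
  calc ∑ χ ∈ F, (1 + z) ^ (S.filter fun v => χ v = c).card
      = ∑ χ ∈ F, ∑ T ∈ S.powerset, if ∀ v ∈ T, χ v = c then z ^ T.card else 0 := by
        refine Finset.sum_congr rfl fun χ _ => ?_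
        rw [hexp, ← Finset.sum_filter]
        refine Finset.sum_congr ?_ fun _ _ => rfl
        ext T
        simp only [Finset.mem_powerset, Finset.mem_filter, Finset.subset_iff]
        grind
    _ = ∑ T ∈ S.powerset, ((F.filter fun χ => ∀ v ∈ T, χ v = c).card : ℝ) * z ^ T.card := by
        rw [Finset.sum_comm]
        refine Finset.sum_congr rfl fun T _ => ?_
        rw [← Finset.sum_filter, Finset.sum_const, nsmul_eq_mul]
    _ ≤ ∑ T ∈ S.powerset, (((n : ℝ) / R.card) ^ T.card * F.card) * z ^ T.card := by
        refine Finset.sum_le_sum fun T hT => ?_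
        gcongr
        exact card_filter_forall_le hF hc ((Finset.mem_powerset.1 hT).trans hS)
    _ = F.card * (1 + z * (n / R.card)) ^ S.card := by
        rw [hexp, Finset.mul_sum]
        refine Finset.sum_congr rfl fun T _ => ?_
        rw [mul_pow]
        ring
    _ ≤ F.card * Real.exp (z * (n / R.card)) ^ S.card := by
        gcongr
        rw [add_comm]
        exact Real.add_one_le_exp _
    _ = _ := by
        rw [← Real.exp_nat_mul]
        congr 2
        ring

theorem card_filter_upper_tail_le (hF : ∀ a ∈ R, ∀ b ∈ R, ∀ χ ∈ F, χ ∘ Equiv.swap a b ∈ F)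
    (hc : ∀ χ ∈ F, (R.filter fun v => χ v = c).card = n) {S : Finset V} (hS : S ⊆ R) (hn : 0 < n)
    {t : ℝ} (ht : 0 ≤ t) (htn : t ≤ 2 * n) :
    ((F.filter fun χ => (n * S.card / R.card : ℝ) + t ≤
      (S.filter fun v => χ v = c).card).card : ℝ) ≤ F.card * Real.exp (-(t ^ 2 / (4 * n))) := by
  have hn' : (0 : ℝ) < n := by exact_mod_cast hn
  set m : ℝ := n * S.card / R.card with hm
  have hmn : m ≤ n := by
    rw [hm, mul_div_assoc]
    refine mul_le_of_le_one_right hn'.le (div_le_one_of_le₀ ?_ (Nat.cast_nonneg _))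
    exact_mod_cast Finset.card_le_card hS
  have hm0 : 0 ≤ m := by positivity
  set l : ℝ := t / (2 * n) with hl
  have hl0 : 0 ≤ l := by positivity
  have hl1 : l ≤ 1 := by
    rw [hl, div_le_one (by positivity)]; exact htn
  have hexp : Real.exp l - 1 ≤ l + l ^ 2 := by
    have := (abs_le.1 (Real.abs_exp_sub_one_sub_id_le (abs_le.2 ⟨by linarith, hl1⟩))).2
    linarith
  have hz : 0 ≤ Real.exp l - 1 := by linarith [Real.one_le_exp hl0]
  have h1 := sum_pow_card_filter_le hF hc hS hz
  rw [add_sub_cancel, ← hm] at h1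
  have h2 : ((F.filter fun χ => m + t ≤ (S.filter fun v => χ v = c).card).card : ℝ) *
      Real.exp (l * (m + t)) ≤ ∑ χ ∈ F, Real.exp l ^ (S.filter fun v => χ v = c).card := by
    rw [← nsmul_eq_mul, ← Finset.sum_const]
    refine le_trans (Finset.sum_le_sum fun χ hχ => ?_)
      (Finset.sum_le_sum_of_subset_of_nonneg (Finset.filter_subset _ _)
        fun χ _ _ => by positivity)
    rw [← Real.exp_nat_mul]
    refine Real.exp_le_exp.2 ?_
    rw [mul_comm]
    gcongr
    exact (Finset.mem_filter.1 hχ).2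
  have h3 := h2.trans h1
  rw [← le_div_iff₀ (Real.exp_pos _), mul_div_assoc, ← Real.exp_sub] at h3
  refine h3.trans ?_
  gcongr
  have e1 : (Real.exp l - 1) * m ≤ (l + l ^ 2) * m := by gcongr
  have e2 : l ^ 2 * m ≤ l ^ 2 * n := by gcongr
  have e3 : l ^ 2 * n - l * t = -(t ^ 2 / (4 * n)) := by
    rw [hl]; field_simp; ring
  linarith

theorem card_filter_two_sided_tail_le
    (hF : ∀ a ∈ R, ∀ b ∈ R, ∀ χ ∈ F, χ ∘ Equiv.swap a b ∈ F)
    (hc : ∀ χ ∈ F, (R.filter fun v => χ v = c).card = n) {S : Finset V} (hS : S ⊆ R) (hn : 0 < n)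
    {t : ℝ} (ht : 0 ≤ t) (htn : t ≤ 2 * n) :
    ((F.filter fun χ => t ≤ |((S.filter fun v => χ v = c).card : ℝ) -
      n * S.card / R.card|).card : ℝ) ≤ 2 * (F.card * Real.exp (-(t ^ 2 / (4 * n)))) := by
  classical
  have h1 := card_filter_upper_tail_le hF hc hS hn ht htn
  have h2 := card_filter_upper_tail_le hF hc (S := R \ S) Finset.sdiff_subset hn ht htn
  rw [two_mul]
  refine le_trans ?_ (add_le_add h1 h2)
  rw [← Nat.cast_add, Nat.cast_le]
  refine le_trans (Finset.card_le_card ?_) (Finset.card_union_le _ _)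
  intro χ hχ
  simp only [Finset.mem_filter, Finset.mem_union] at hχ ⊢
  obtain ⟨hχF, hχt⟩ := hχ
  rcases le_abs.1 hχt with h | h
  · exact Or.inl ⟨hχF, by linarith⟩
  · refine Or.inr ⟨hχF, ?_⟩
    have hRn := hc χ hχF
    have hR0 : (0 : ℝ) < R.card := by
      have := Finset.card_filter_le R fun v => χ v = c
      have : 0 < R.card := by omega
      exact_mod_cast this
    have hsplit : ((R \ S).filter fun v => χ v = c).card + (S.filter fun v => χ v = c).card = n := by
      rw [← hRn, ← Finset.card_union_of_disjoint
        (Finset.disjoint_filter_filter Finset.sdiff_disjoint), ← Finset.filter_union,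
        Finset.sdiff_union_of_subset hS]
    have hsplit' : (((R \ S).filter fun v => χ v = c).card : ℝ) +
        (S.filter fun v => χ v = c).card = n := by exact_mod_cast hsplit
    rw [Finset.card_sdiff_of_subset hS, Nat.cast_sub (Finset.card_le_card hS), mul_sub, sub_div,
      mul_div_cancel_right₀ _ hR0.ne']
    linarith

end concentration

section colouring
variable {V : Type} [Fintype V] {r : ℕ}

/-- The part of colour `j`. -/
def colourPart (χ : V → Option (Fin r)) (j : Fin r) : Finset V := univ.filter fun v => χ v = some j

/-- The colours with index at least `i`. -/
def IsLate (i : ℕ) (c : Option (Fin r)) : Prop := ∃ j : Fin r, c = some j ∧ i ≤ j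

open Classical in
/-- The colourings with parts of size `n` that differ from `χ₀` only by a rearrangement of the
parts with index at least `i`. -/
noncomputable def colouringClass (n i : ℕ) (χ₀ : V → Option (Fin r)) : Finset (V → Option (Fin r)) :=
  univ.filter fun χ => (∀ j, (colourPart χ j).card = n) ∧
    ∀ v, χ v = χ₀ v ∨ (IsLate i (χ v) ∧ IsLate i (χ₀ v))

theorem mem_colourPart {χ : V → Option (Fin r)} {j : Fin r} {v : V} :
    v ∈ colourPart χ j ↔ χ v = some j := by simp [colourPart]

theorem mem_colouringClass {n i : ℕ} {χ₀ χ : V → Option (Fin r)} :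
    χ ∈ colouringClass n i χ₀ ↔ (∀ j, (colourPart χ j).card = n) ∧
      ∀ v, χ v = χ₀ v ∨ (IsLate i (χ v) ∧ IsLate i (χ₀ v)) := by
  simp [colouringClass]

theorem disjoint_colourPart (χ : V → Option (Fin r)) (i j : Fin r) (hij : i ≠ j) :
    Disjoint (colourPart χ i) (colourPart χ j) := by
  rw [Finset.disjoint_left]
  intro v hi hj
  rw [mem_colourPart] at hi hj
  exact hij (Option.some_injective _ (hi.symm.trans hj))

theorem IsLate.mono {i j : ℕ} (hij : i ≤ j) {c : Option (Fin r)} (h : IsLate j c) : IsLate i c := by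
  obtain ⟨k, hk, hjk⟩ := h
  exact ⟨k, hk, hij.trans hjk⟩

theorem isLate_iff {i : Fin r} {c : Option (Fin r)} :
    IsLate i c ↔ c = some i ∨ IsLate (i + 1) c := by
  constructor
  · rintro ⟨k, hk, hik⟩
    rcases hik.eq_or_lt with h | h
    · exact Or.inl (by rw [hk, Fin.ext h])
    · exact Or.inr ⟨k, hk, h⟩
  · rintro (h | h)
    · exact ⟨i, h, le_rfl⟩
    · exact h.mono (Nat.le_succ _)

/-- Fixing one more part of a colouring class. -/
theorem mem_colouringClass_succ {n : ℕ} {i : Fin r} {χ₀ χ₁ χ : V → Option (Fin r)}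
    (h₁ : χ₁ ∈ colouringClass n i χ₀) :
    χ ∈ colouringClass n (i + 1) χ₁ ↔
      χ ∈ colouringClass n i χ₀ ∧ colourPart χ i = colourPart χ₁ i := by
  have hnot : ∀ c : Option (Fin r), IsLate (i + 1) c → c ≠ some i := by
    rintro c ⟨k, rfl, hk⟩ h
    rw [Option.some_inj] at h
    subst h
    omega
  obtain ⟨_, h₁⟩ := mem_colouringClass.1 h₁
  rw [mem_colouringClass, mem_colouringClass, and_assoc]
  refine and_congr_right fun _ => ⟨fun h => ⟨fun v => ?_, ?_⟩, fun ⟨h, hp⟩ v => ?_⟩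
  · rcases h v with hv | ⟨hv, hv'⟩
    · rw [hv]; exact h₁ v
    · refine Or.inr ⟨hv.mono (Nat.le_succ _), ?_⟩
      rcases h₁ v with hw | ⟨_, hw⟩
      · rw [← hw]; exact hv'.mono (Nat.le_succ _)
      · exact hw
  · ext v
    rw [mem_colourPart, mem_colourPart]
    rcases h v with hv | ⟨hv, hv'⟩
    · rw [hv]
    · exact ⟨fun h => absurd h (hnot _ hv), fun h => absurd h (hnot _ hv')⟩
  · have hp' : χ v = some i ↔ χ₁ v = some i := by
      rw [← mem_colourPart, ← mem_colourPart, hp]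
    by_cases hl : IsLate i (χ v) ∧ IsLate i (χ₁ v)
    · rw [isLate_iff, isLate_iff] at hl
      rcases hl with ⟨hl | hl, hl' | hl'⟩
      · exact Or.inl (hl.trans hl'.symm)
      · exact absurd (hp'.1 hl) (hnot _ hl')
      · exact absurd (hp'.2 hl') (hnot _ hl)
      · exact Or.inr ⟨hl, hl'⟩
    · left
      rcases h v with hv | ⟨hv, hv'⟩ <;> rcases h₁ v with hw | ⟨hw, hw'⟩
      · rw [hv, hw]
      · exact absurd ⟨by rwa [hv], hw⟩ hl
      · exact absurd ⟨hv, by rwa [hw]⟩ hl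
      · exact absurd ⟨hv, hw⟩ hl

variable [DecidableEq V]

/-- The numbers of elements of a set in the parts of a colouring. -/
def partCounts (χ : V → Option (Fin r)) (S : Finset V) : Fin r → ℤ :=
  fun j => ((S ∩ colourPart χ j).card : ℤ)

theorem inGrid_partCounts {n i : ℕ} {χ₀ χ : V → Option (Fin r)} (h : χ ∈ colouringClass n i χ₀)
    (S : Finset V) : InGrid n (partCounts χ S) := fun j => by
  have := Finset.card_le_card (Finset.inter_subset_right (s₁ := S) (s₂ := colourPart χ j))
  rw [(mem_colouringClass.1 h).1 j] at this
  exact ⟨Nat.cast_nonneg _, Nat.cast_le.2 this⟩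

theorem sum_partCounts (χ : V → Option (Fin r)) (S : Finset V) :
    ∑ j, partCounts χ S j = ((S.filter fun v => χ v ≠ none).card : ℤ) := by
  unfold partCounts
  rw [← Nat.cast_sum, ← Finset.card_biUnion]
  · congr 2
    ext v
    simp [mem_colourPart, Option.ne_none_iff_exists']
  · intro i _ j _ hij
    exact (disjoint_colourPart χ i j hij).mono Finset.inter_subset_right Finset.inter_subset_right

theorem partCounts_congr {n : ℕ} {i : Fin r} {χ₁ χ : V → Option (Fin r)}
    (h : χ ∈ colouringClass n (i + 1) χ₁) (S : Finset V) :
    (∀ j, j ≤ i → partCounts χ S j = partCounts χ₁ S j) ∧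
      ∑ j, partCounts χ S j = ∑ j, partCounts χ₁ S j := by
  obtain ⟨_, h⟩ := mem_colouringClass.1 h
  constructor
  · intro j hj
    unfold partCounts
    congr 3
    ext v
    rw [mem_colourPart, mem_colourPart]
    rcases h v with hv | ⟨⟨k, hk, hik⟩, ⟨l, hl, hil⟩⟩
    · rw [hv]
    · rw [hk, hl, Option.some_inj, Option.some_inj]
      rw [Fin.le_def] at hj
      constructor <;> rintro rfl <;> omega
  · rw [sum_partCounts, sum_partCounts]
    congr 2
    refine Finset.filter_congr fun v _ => ?_
    rcases h v with hv | ⟨⟨k, hk, hik⟩, ⟨l, hl, hil⟩⟩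
    · rw [hv]
    · simp [hk, hl]

open Classical in
/-- Most colourings of a class split a given set in a balanced way. -/
theorem card_not_isBalanced_le {n g : ℕ} (i : Fin r) (χ₀ : V → Option (Fin r)) (hn : 0 < n)
    (hg : g ≤ 32 * n) (S : Finset V) :
    (((colouringClass n i χ₀).filter fun χ => ¬ IsBalanced g i (partCounts χ S)).card : ℝ) ≤
      2 * r * Real.exp (-((g : ℝ) ^ 2 / (1024 * n))) * (colouringClass n i χ₀).card := by
  set F := colouringClass n i χ₀ with hFdef
  set R : Finset V := univ.filter fun v => IsLate i (χ₀ v) with hR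
  have hlate : ∀ χ ∈ F, ∀ v, IsLate i (χ v) ↔ v ∈ R := by
    intro χ hχ v
    rw [hR, Finset.mem_filter]
    rcases (mem_colouringClass.1 hχ).2 v with hv | ⟨hv, hv'⟩
    · simp [hv]
    · simp [hv, hv']
  have hswap : ∀ a ∈ R, ∀ b ∈ R, ∀ χ ∈ F, χ ∘ Equiv.swap a b ∈ F := by
    intro a ha b hb χ hχ
    have hχ' := mem_colouringClass.1 hχ
    refine mem_colouringClass.2 ⟨fun j => ?_, fun v => ?_⟩
    · rw [← hχ'.1 j]
      refine Finset.card_bij' (fun v _ => Equiv.swap a b v) (fun v _ => Equiv.swap a b v)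
        ?_ ?_ ?_ ?_ <;> simp [mem_colourPart]
    · by_cases hv : v = a ∨ v = b
      · have hvR : v ∈ R := by rcases hv with rfl | rfl <;> assumption
        have hsR : Equiv.swap a b v ∈ R := by rcases hv with rfl | rfl <;> simpa
        exact Or.inr ⟨(hlate χ hχ _).2 hsR, (Finset.mem_filter.1 hvR).2⟩
      · push Not at hv
        rw [Function.comp_apply, Equiv.swap_apply_of_ne_of_ne hv.1 hv.2]
        exact hχ'.2 v
  have hpart : ∀ χ ∈ F, ∀ j : Fin r, i ≤ j → ∀ T : Finset V,
      T ∩ colourPart χ j = (T ∩ R).filter fun v => χ v = some j := by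
    intro χ hχ j hj T
    ext v
    simp only [Finset.mem_inter, Finset.mem_filter, mem_colourPart]
    constructor
    · exact fun ⟨h1, h2⟩ => ⟨⟨h1, (hlate χ hχ v).1 ⟨j, h2, hj⟩⟩, h2⟩
    · exact fun ⟨⟨h1, _⟩, h2⟩ => ⟨h1, h2⟩
  have hcard : ∀ j : Fin r, i ≤ j → ∀ χ ∈ F, (R.filter fun v => χ v = some j).card = n := by
    intro j hj χ hχ
    rw [← (mem_colouringClass.1 hχ).1 j, ← Finset.univ_inter (colourPart χ j), hpart χ hχ j hj,
      Finset.univ_inter]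
  set m : ℝ := n * (S ∩ R).card / R.card with hm
  have htail : ∀ j ∈ univ.filter (fun j : Fin r => i ≤ j),
      ((F.filter fun χ => (g : ℝ) / 16 ≤
        |(((S ∩ R).filter fun v => χ v = some j).card : ℝ) - m|).card : ℝ) ≤
      2 * (F.card * Real.exp (-((g : ℝ) ^ 2 / (1024 * n)))) := by
    intro j hj
    have hgn : (g : ℝ) ≤ 32 * n := by exact_mod_cast hg
    have := card_filter_two_sided_tail_le hswap (hcard j (Finset.mem_filter.1 hj).2)
      (Finset.inter_subset_right (s₁ := S) (s₂ := R)) hn (t := (g : ℝ) / 16) (by positivity)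
      (by linarith)
    have he : ((g : ℝ) / 16) ^ 2 / (4 * n) = (g : ℝ) ^ 2 / (1024 * n) := by
      rw [div_pow, div_div]; congr 1; ring
    rwa [he] at this
  have hcover : (F.filter fun χ => ¬ IsBalanced g i (partCounts χ S)) ⊆
      (univ.filter fun j : Fin r => i ≤ j).biUnion fun j => F.filter fun χ => (g : ℝ) / 16 ≤
        |(((S ∩ R).filter fun v => χ v = some j).card : ℝ) - m| := by
    intro χ hχ
    obtain ⟨hχF, hχb⟩ := Finset.mem_filter.1 hχ
    by_contra hcon
    refine hχb fun j hj => ?_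
    have hclose : ∀ k : Fin r, i ≤ k → |(partCounts χ S k : ℝ) - m| < g / 16 := by
      intro k hk
      by_contra! hlt
      refine hcon (Finset.mem_biUnion.2 ⟨k, by simpa using hk, Finset.mem_filter.2 ⟨hχF, ?_⟩⟩)
      rw [partCounts, hpart χ hχF k hk] at hlt
      exact_mod_cast hlt
    have h1 := abs_lt.1 (hclose i le_rfl)
    have h2 := abs_lt.1 (hclose j hj.le)
    constructor <;> linarith
  calc ((F.filter fun χ => ¬ IsBalanced g i (partCounts χ S)).card : ℝ)
      ≤ ∑ j ∈ univ.filter fun j : Fin r => i ≤ j, ((F.filter fun χ => (g : ℝ) / 16 ≤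
        |(((S ∩ R).filter fun v => χ v = some j).card : ℝ) - m|).card : ℝ) := by
        exact_mod_cast (Finset.card_le_card hcover).trans Finset.card_biUnion_le
    _ ≤ ∑ _j ∈ univ.filter fun j : Fin r => i ≤ j,
        2 * (F.card * Real.exp (-((g : ℝ) ^ 2 / (1024 * n)))) := Finset.sum_le_sum htail
    _ ≤ r * (2 * (F.card * Real.exp (-((g : ℝ) ^ 2 / (1024 * n))))) := by
        rw [Finset.sum_const, nsmul_eq_mul]
        gcongr
        exact (Finset.card_filter_le _ _).trans (by simp)
    _ = _ := by ring

/-- The hard functions: the normalized set function of a colouring. -/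
noncomputable def hardFn (n g : ℕ) (χ : V → Option (Fin r)) (S : Finset V) : ℝ :=
  (inducedFn (colourPart χ) (hStarPrime n g r) S : ℝ) / (n * r)

open Classical in
/-- A deterministic algorithm with few rounds fails on most functions of a colouring class. -/
theorem card_success_le {n g : ℕ} {q δ ε : ℝ} (hq : 0 ≤ q) (hδ : 0 ≤ δ)
    (hbal : ∀ (i : Fin r) (χ₀ : V → Option (Fin r)) (S : Finset V),
      (((colouringClass n i χ₀).filter fun χ => ¬ IsBalanced g i (partCounts χ S)).card : ℝ) ≤
        δ * (colouringClass n i χ₀).card)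
    (hans : ∀ (i : Fin r) (χ₀ χ : V → Option (Fin r)) (S : Finset V), 2 * ((i : ℕ) + 1) < r →
      χ ∈ colouringClass n (i + 1) χ₀ → IsBalanced g i (partCounts χ S) →
      IsBalanced g i (partCounts χ₀ S) → hardFn n g χ S = hardFn n g χ₀ S)
    (hout : ∀ (i : Fin r) (χ₀ χ : V → Option (Fin r)) (S : Finset V), 2 * ((i : ℕ) + 1) < r →
      χ ∈ colouringClass n i χ₀ → IsBalanced g i (partCounts χ S) →
      ¬ IsApproxMinimizer (hardFn n g χ) ε S) :
    ∀ {s : ℕ} (A : RoundAlg V q s) (i : ℕ) (χ₀ : V → Option (Fin r)), 2 * (i + s + 1) < r →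
      (((colouringClass n i χ₀).filter fun χ =>
        IsApproxMinimizer (hardFn n g χ) ε (A.run (hardFn n g χ))).card : ℝ) ≤
      (s * q + 1) * δ * (colouringClass n i χ₀).card
  | s, .output S, i, χ₀, hi => by
    have hir : i < r := by omega
    have h1 := hbal ⟨i, hir⟩ χ₀ S
    have h2 : ((colouringClass n i χ₀).filter fun χ =>
        IsApproxMinimizer (hardFn n g χ) ε ((RoundAlg.output (q := q) (s := s) S).run
          (hardFn n g χ))) ⊆
        (colouringClass n i χ₀).filter fun χ => ¬ IsBalanced g ⟨i, hir⟩ (partCounts χ S) := by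
      intro χ hχ
      rw [Finset.mem_filter] at hχ ⊢
      refine ⟨hχ.1, fun hb => hout ⟨i, hir⟩ χ₀ χ S (by simp only; omega) hχ.1 hb ?_⟩
      simpa [RoundAlg.run] using hχ.2
    refine (Nat.cast_le.2 (Finset.card_le_card h2)).trans (h1.trans ?_)
    gcongr
    have : 0 ≤ s * q := by positivity
    nlinarith
  | s + 1, .round Q hQ next, i, χ₀, hi => by
    have hir : i < r := by omega
    set k : Fin r := ⟨i, hir⟩ with hk
    set F := colouringClass n i χ₀ with hF
    set W := F.filter fun χ => IsApproxMinimizer (hardFn n g χ) ε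
      ((RoundAlg.round Q hQ next).run (hardFn n g χ)) with hW
    set B := Q.biUnion fun S => F.filter fun χ => ¬ IsBalanced g k (partCounts χ S) with hB
    have hBcard : (B.card : ℝ) ≤ q * δ * F.card := by
      calc (B.card : ℝ) ≤ ∑ S ∈ Q, ((F.filter fun χ =>
            ¬ IsBalanced g k (partCounts χ S)).card : ℝ) := by
              exact_mod_cast Finset.card_biUnion_le
        _ ≤ ∑ S ∈ Q, δ * F.card := Finset.sum_le_sum fun S _ => hbal k χ₀ S
        _ = Q.card * (δ * F.card) := by rw [Finset.sum_const, nsmul_eq_mul]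
        _ ≤ q * (δ * F.card) := by gcongr
        _ = q * δ * F.card := by ring
    have hgood : ((W \ B).card : ℝ) ≤ (s * q + 1) * δ * F.card := by
      have hfib : ∀ P ∈ F.image fun χ => colourPart χ k,
          (((W \ B).filter fun χ => colourPart χ k = P).card : ℝ) ≤
            (s * q + 1) * δ * ((F.filter fun χ => colourPart χ k = P).card : ℝ) := by
        intro P _
        rcases ((W \ B).filter fun χ => colourPart χ k = P).eq_empty_or_nonempty with he | ⟨χ₁, h₁⟩
        · rw [he, Finset.card_empty, Nat.cast_zero]
          positivity
        · obtain ⟨h₁', rfl⟩ := Finset.mem_filter.1 h₁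
          obtain ⟨h₁W, h₁B⟩ := Finset.mem_sdiff.1 h₁'
          have h₁F : χ₁ ∈ F := (Finset.mem_filter.1 h₁W).1
          have hsub : F.filter (fun χ => colourPart χ k = colourPart χ₁ k) =
              colouringClass n (i + 1) χ₁ := by
            ext χ
            rw [Finset.mem_filter]
            exact (mem_colouringClass_succ (i := k) h₁F).symm
          have hbalQ : ∀ χ ∈ F, χ ∉ B → ∀ S ∈ Q, IsBalanced g k (partCounts χ S) := by
            intro χ hχ hχB S hS
            by_contra hcon
            exact hχB (Finset.mem_biUnion.2 ⟨S, hS, Finset.mem_filter.2 ⟨hχ, hcon⟩⟩)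
          have ih := card_success_le hq hδ hbal hans hout (next fun S => hardFn n g χ₁ S.1) (i + 1)
            χ₁ (by omega)
          rw [hsub]
          refine le_trans (Nat.cast_le.2 (Finset.card_le_card fun χ hχ => ?_)) ih
          obtain ⟨hχ, hχP⟩ := Finset.mem_filter.1 hχ
          obtain ⟨hχW, hχB⟩ := Finset.mem_sdiff.1 hχ
          obtain ⟨hχF, hχs⟩ := Finset.mem_filter.1 hχW
          have hχc : χ ∈ colouringClass n (i + 1) χ₁ := by
            rw [← hsub]; exact Finset.mem_filter.2 ⟨hχF, hχP⟩
          refine Finset.mem_filter.2 ⟨hχc, ?_⟩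
          have hsame : (fun S : {S // S ∈ Q} => hardFn n g χ S.1) =
              fun S => hardFn n g χ₁ S.1 := funext fun S =>
            hans k χ₁ χ S.1 (by simp only [hk]; omega) hχc (hbalQ χ hχF hχB S.1 S.2)
              (hbalQ χ₁ h₁F h₁B S.1 S.2)
          rw [RoundAlg.run, hsame] at hχs
          exact hχs
      have e1 := Finset.card_eq_sum_card_image (fun χ => colourPart χ k) F
      have e2 := Finset.card_eq_sum_card_fiberwise (f := fun χ => colourPart χ k)
        (s := W \ B) (t := F.image fun χ => colourPart χ k) (fun χ hχ => by
          have : χ ∈ F := (Finset.mem_filter.1 (Finset.mem_sdiff.1 hχ).1).1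
          exact Finset.mem_coe.2 (Finset.mem_image_of_mem _ this))
      rw [e1, e2, Nat.cast_sum, Nat.cast_sum, Finset.mul_sum]
      exact Finset.sum_le_sum hfib
    have hWle : (W.card : ℝ) ≤ (W \ B).card + B.card := by
      have : W.card ≤ (W \ B).card + B.card := by
        have := Finset.card_le_card (Finset.subset_union_left (s₁ := W) (s₂ := B))
        rw [← Finset.sdiff_union_self_eq_union] at this
        exact this.trans (Finset.card_union_le _ _)
      exact_mod_cast this
    calc (W.card : ℝ) ≤ (W \ B).card + B.card := hWle
      _ ≤ (s * q + 1) * δ * F.card + q * δ * F.card := add_le_add hgood hBcard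
      _ = _ := by push_cast; ring

theorem hardFn_congr {n g : ℕ} (hn : Even n) (hg : 4 ∣ g) (i : Fin r)
    (χ₀ χ : V → Option (Fin r)) (S : Finset V) (hi : 2 * ((i : ℕ) + 1) < r)
    (hχ : χ ∈ colouringClass n (i + 1) χ₀) (hb : IsBalanced g i (partCounts χ S))
    (hb₀ : IsBalanced g i (partCounts χ₀ S)) : hardFn n g χ S = hardFn n g χ₀ S := by
  obtain ⟨h1, h2⟩ := partCounts_congr hχ S
  have : hStarPrime n g r (partCounts χ S) = hStarPrime n g r (partCounts χ₀ S) := by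
    rw [hStarPrime_eq_hFun_of_balanced hn hg hi hb, hStarPrime_eq_hFun_of_balanced hn hg hi hb₀]
    exact hFun_eq_of_balanced hg (by omega) hb hb₀ h1 h2
  unfold hardFn inducedFn
  unfold partCounts at this
  rw [this]

theorem hardFn_lastThird {n g i : ℕ} (hn : Even n) (hg : 4 ∣ g) (h3 : 3 ∣ r)
    (hgr : 5 * g * r ≤ n) (hr : 0 < r) (hn0 : 0 < n) {χ₀ χ : V → Option (Fin r)}
    (hχ : χ ∈ colouringClass n i χ₀) :
    hardFn n g χ ((lastThird r).biUnion (colourPart χ)) = -(g / (6 * n)) := by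
  have hval := hStarPrime_lastThird hn hg h3 hgr
  rw [← inducedFn_biUnion (mem_colouringClass.1 hχ).1 (disjoint_colourPart χ) _
    (hStarPrime n g r)] at hval
  have hval' : (6 * inducedFn (colourPart χ) (hStarPrime n g r)
      ((lastThird r).biUnion (colourPart χ)) : ℝ) = -(g * r) := by exact_mod_cast hval
  have hr' : (0 : ℝ) < r := by exact_mod_cast hr
  have hn' : (0 : ℝ) < n := by exact_mod_cast hn0
  unfold hardFn
  rw [div_eq_iff (by positivity)]
  field_simp
  linarith

theorem not_isApproxMinimizer_of_balanced {n g : ℕ} {ε : ℝ} (hn : Even n) (hg : 4 ∣ g) (h3 : 3 ∣ r)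
    (hgr : 5 * g * r ≤ n) (hn0 : 0 < n) (hε : ε < g / (6 * n)) (i : Fin r)
    (χ₀ χ : V → Option (Fin r)) (S : Finset V) (hi : 2 * ((i : ℕ) + 1) < r)
    (hχ : χ ∈ colouringClass n i χ₀) (hb : IsBalanced g i (partCounts χ S)) :
    ¬ IsApproxMinimizer (hardFn n g χ) ε S := by
  intro h
  have h1 := h ((lastThird r).biUnion (colourPart χ))
  rw [hardFn_lastThird hn hg h3 hgr (by omega) hn0 hχ] at h1
  have h2 : 0 ≤ hardFn n g χ S := by
    have := hFun_nonneg hn hg hgr (inGrid_partCounts hχ S)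
    rw [← hStarPrime_eq_hFun_of_balanced hn hg hi hb] at this
    refine div_nonneg ?_ (by positivity)
    exact_mod_cast this
  linarith

theorem isSubmodular_hardFn (n g : ℕ) (χ : V → Option (Fin r)) : IsSubmodular (hardFn n g χ) := by
  intro A B e hAB he
  have := isSubmodular_inducedFn (disjoint_colourPart χ) (hStarPrime_submodular n g r) A B e hAB he
  unfold hardFn
  rw [← sub_div, ← sub_div]
  refine div_le_div_of_nonneg_right ?_ (by positivity)
  exact_mod_cast this

theorem hardFn_mem_Icc {n g i : ℕ} (hn : Even n) (hg : 4 ∣ g) (h3 : 3 ∣ r)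
    (hgr : 5 * g * r ≤ n) (hr : 0 < r) (hn0 : 0 < n) {χ₀ χ : V → Option (Fin r)}
    (hχ : χ ∈ colouringClass n i χ₀) (S : Finset V) :
    -1 ≤ hardFn n g χ S ∧ hardFn n g χ S ≤ 1 := by
  have hgrid := inGrid_partCounts hχ S
  have h1 := neg_gap_le_hStarPrime hn hg h3 hgr hgrid
  have h2 := hStarPrime_le_sum n g r (partCounts χ S)
  have h3 : ∑ j, partCounts χ S j ≤ r * n := by
    rw [← sum_const_fin]
    exact Finset.sum_le_sum fun j _ => (hgrid j).2
  have hr' : (0 : ℝ) < r := by exact_mod_cast hr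
  have hn' : (0 : ℝ) < n := by exact_mod_cast hn0
  have h4 : (g : ℤ) * r ≤ r * n := by
    have : g * r ≤ r * n := by nlinarith
    exact_mod_cast this
  unfold hardFn
  rw [le_div_iff₀ (by positivity), div_le_one (by positivity)]
  have h5 : -((n : ℤ) * r) ≤ hStarPrime n g r (partCounts χ S) := by linarith
  have h6 : hStarPrime n g r (partCounts χ S) ≤ n * r := by linarith
  constructor
  · have : ((-((n : ℤ) * r) : ℤ) : ℝ) ≤ hStarPrime n g r (partCounts χ S) := Int.cast_le.2 h5
    push_cast at this
    rw [neg_one_mul]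
    exact this
  · have : (hStarPrime n g r (partCounts χ S) : ℝ) ≤ ((n * r : ℤ) : ℝ) := Int.cast_le.2 h6
    push_cast at this
    exact this

end colouring

/-- The colouring of `Fin N` by consecutive blocks of length `n`. -/
def blockColouring (N n r : ℕ) : Fin N → Option (Fin r) := fun v =>
  if h : (v : ℕ) / n < r then some ⟨v / n, h⟩ else none

theorem card_colourPart_blockColouring {N n r : ℕ} (hn : 0 < n) (hN : n * r ≤ N) (j : Fin r) :
    (colourPart (blockColouring N n r) j).card = n := by
  have hmap : (colourPart (blockColouring N n r) j).map Fin.valEmbedding =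
      Finset.Ico (j * n) ((j + 1) * n) := by
    ext v
    have hj : ((j : ℕ) + 1) * n ≤ N := by
      calc ((j : ℕ) + 1) * n ≤ r * n := Nat.mul_le_mul_right _ j.2
        _ ≤ N := by linarith
    have hdiv : v / n = j ↔ j * n ≤ v ∧ v < (j + 1) * n := by
      rw [Nat.div_eq_iff hn, Nat.lt_iff_le_pred (by positivity), add_mul, one_mul]
    rw [Finset.mem_Ico, ← hdiv, Finset.mem_map]
    constructor
    · rintro ⟨w, hw, rfl⟩
      rw [mem_colourPart, blockColouring] at hw
      split_ifs at hw with h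
      rw [Option.some_inj] at hw
      rw [← hw]
      rfl
    · intro hv
      refine ⟨⟨v, (hdiv.1 hv).2.trans_le hj⟩, ?_, rfl⟩
      rw [mem_colourPart, blockColouring]
      simp [hv]
  rw [← Finset.card_map Fin.valEmbedding, hmap, Nat.card_Ico, add_mul, one_mul, Nat.add_sub_cancel_left]

theorem blockColouring_mem {N n r : ℕ} (hn : 0 < n) (hN : n * r ≤ N) :
    blockColouring N n r ∈ colouringClass n 0 (blockColouring N n r) :=
  mem_colouringClass.2 ⟨card_colourPart_blockColouring hn hN, fun _ => Or.inl rfl⟩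

open Classical in
/-- If each event of a finite family has probability at least `2/3` and no point lies in more than a
fraction `θ` of the events, then `θ ≥ 2/3`. -/
theorem two_thirds_le_of_card_le {Ω ι : Type*} [MeasurableSpace Ω] (μ : Measure Ω)
    [IsProbabilityMeasure μ] {F : Finset ι} (hF : F.Nonempty) (E : ι → Set Ω)
    (hE : ∀ χ ∈ F, MeasurableSet (E χ) ∧ 2 / 3 ≤ μ.real (E χ)) {θ : ℝ}
    (hθ : ∀ ω, ((F.filter fun χ => ω ∈ E χ).card : ℝ) ≤ θ * F.card) : 2 / 3 ≤ θ := by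
  have hint : ∀ χ ∈ F, Integrable ((E χ).indicator fun _ => (1 : ℝ)) μ := fun χ hχ =>
    (integrable_const 1).indicator (hE χ hχ).1
  have h1 : ∑ χ ∈ F, μ.real (E χ) = ∫ ω, ∑ χ ∈ F, (E χ).indicator (fun _ => (1 : ℝ)) ω ∂μ := by
    rw [integral_finsetSum _ hint]
    refine Finset.sum_congr rfl fun χ hχ => ?_
    rw [integral_indicator_const _ (hE χ hχ).1, smul_eq_mul, mul_one]
  have h2 : ∫ ω, ∑ χ ∈ F, (E χ).indicator (fun _ => (1 : ℝ)) ω ∂μ ≤ ∫ _ω, θ * F.card ∂μ := by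
    refine integral_mono (integrable_finsetSum _ hint) (integrable_const _) fun ω => ?_
    refine le_trans (le_of_eq ?_) (hθ ω)
    simp [Set.indicator_apply, Finset.sum_boole]
  have h3 : ∑ _χ ∈ F, (2 / 3 : ℝ) ≤ ∑ χ ∈ F, μ.real (E χ) :=
    Finset.sum_le_sum fun χ hχ => (hE χ hχ).2
  rw [h1] at h3
  rw [integral_const, probReal_univ, one_smul] at h2
  rw [Finset.sum_const, nsmul_eq_mul] at h3
  have hc : (0 : ℝ) < F.card := by exact_mod_cast hF.card_pos
  nlinarith

/-- No algorithm solves the problem in few rounds for suitable parameters of the construction. -/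
theorem two_thirds_le_of_solves {N n g r s : ℕ} {q ε : ℝ} (hq : 0 ≤ q) (hn : Even n) (hg : 4 ∣ g)
    (h3 : 3 ∣ r) (hgr : 5 * g * r ≤ n) (hn0 : 0 < n) (hN : n * r ≤ N) (hε : ε < g / (6 * n))
    (hs : 2 * (s + 1) < r) {Ω : Type*} [MeasurableSpace Ω] (μ : Measure Ω) [IsProbabilityMeasure μ]
    (A : Ω → RoundAlg (Fin N) q s) (hA : SolvesApproxSFM μ A ε) :
    2 / 3 ≤ (s * q + 1) * (2 * r * Real.exp (-((g : ℝ) ^ 2 / (1024 * n)))) := by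
  classical
  have hr : 0 < r := by omega
  have hgn : g ≤ 32 * n := by nlinarith
  have hmem := blockColouring_mem (r := r) hn0 hN
  refine two_thirds_le_of_card_le μ ⟨_, hmem⟩
    (fun χ => {ω | IsApproxMinimizer (hardFn n g χ) ε ((A ω).run (hardFn n g χ))})
    (fun χ hχ => hA _ (isSubmodular_hardFn n g χ) (hardFn_mem_Icc hn hg h3 hgr hr hn0 hχ))
    fun ω => ?_
  have := card_success_le (V := Fin N) (r := r) (ε := ε) hq (by positivity)
    (fun i χ₀ S => card_not_isBalanced_le i χ₀ hn0 hgn S)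
    (fun i χ₀ χ S hi hχ hb hb₀ => hardFn_congr hn hg i χ₀ χ S hi hχ hb hb₀)
    (fun i χ₀ χ S hi hχ hb =>
      not_isApproxMinimizer_of_balanced hn hg h3 hgr hn0 hε i χ₀ χ S hi hχ hb)
    (A ω) 0 (blockColouring N n r) (by omega)
  simp only [Set.mem_ofPred_eq]
  convert this

/-- Without queries, approximate minimization is impossible. -/
theorem rounds_ne_zero {N : ℕ} (hN : 0 < N) {q ε : ℝ} (hε : ε ≤ 1) {Ω : Type*} [MeasurableSpace Ω]
    (μ : Measure Ω) [IsProbabilityMeasure μ] (A : Ω → RoundAlg (Fin N) q 0) :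
    ¬ SolvesApproxSFM μ A ε := by
  classical
  intro hA
  set u : Fin N := ⟨0, hN⟩
  let f : Bool → Finset (Fin N) → ℝ := fun b S => if decide (u ∈ S) = b then -1 else 1
  have hsub : ∀ b, IsSubmodular (f b) := by
    intro b S T e hST heT
    have heS : e ∉ S := fun h => heT (hST h)
    by_cases hu : u = e
    · subst hu
      simp [f, heT, heS]
    · simp [f, hu]
  have hrange : ∀ b S, -1 ≤ f b S ∧ f b S ≤ 1 := by
    intro b S
    simp only [f]
    split_ifs <;> norm_num
  have := two_thirds_le_of_card_le μ (F := (univ : Finset Bool)) ⟨true, mem_univ _⟩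
    (fun b => {ω | IsApproxMinimizer (f b) ε ((A ω).run (f b))})
    (fun b _ => hA (f b) (hsub b) (hrange b)) (θ := 1 / 2) fun ω => by
      obtain ⟨S, hS⟩ : ∃ S, A ω = RoundAlg.output S := by
        cases h : A ω with
        | output S => exact ⟨S, rfl⟩
      have hle : (univ.filter fun b => ω ∈ {ω | IsApproxMinimizer (f b) ε ((A ω).run (f b))}).card
          ≤ 1 := by
        refine Finset.card_le_one.2 fun a ha b hb => ?_
        have key : ∀ b, IsApproxMinimizer (f b) ε S → decide (u ∈ S) = b := by
          intro b hb
          by_contra hne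
          have h1 := hb (if b = true then univ else ∅)
          have h2 : f b (if b = true then univ else ∅) = -1 := by cases b <;> simp [f]
          have h3 : f b S = 1 := by simp [f, hne]
          rw [h2, h3] at h1
          linarith
        simp only [Finset.mem_filter, Set.mem_ofPred_eq, hS, RoundAlg.run] at ha hb
        rw [← key a ha.2, ← key b hb.2]
      have : ((univ.filter fun b =>
          ω ∈ {ω | IsApproxMinimizer (f b) ε ((A ω).run (f b))}).card : ℝ) ≤ 1 := by
        exact_mod_cast hle
      refine le_trans (le_of_eq ?_) (this.trans (by simp))
      congr!
  norm_num at this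

/-- The failure probability of the construction is small. -/
theorem failure_lt {N n g r s : ℕ} {c : ℝ} (hN : 3 ≤ N) (hc : 1 ≤ c) (hn : 0 < n)
    (hr : r ≤ N) (hs : s < N) (hg : 5120 * (c * n * Real.log N) ≤ (g : ℝ) ^ 2) :
    (s * (N : ℝ) ^ c + 1) * (2 * r * Real.exp (-((g : ℝ) ^ 2 / (1024 * n)))) < 2 / 3 := by
  have hN0 : (0 : ℝ) < N := by
    have : 0 < N := by omega
    exact_mod_cast this
  have hN3 : (3 : ℝ) ≤ N := by exact_mod_cast hN
  have hn' : (0 : ℝ) < n := by exact_mod_cast hn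
  have hrR : (r : ℝ) ≤ N := by exact_mod_cast hr
  have hsR : (s : ℝ) + 1 ≤ N := by exact_mod_cast hs
  have hNc : 1 ≤ (N : ℝ) ^ c := Real.one_le_rpow (by linarith) (by linarith)
  have he : Real.exp (-((g : ℝ) ^ 2 / (1024 * n))) ≤ (N : ℝ) ^ (-(5 * c)) := by
    rw [Real.rpow_def_of_pos hN0]
    refine Real.exp_le_exp.2 ?_
    have : 5 * c * Real.log N ≤ (g : ℝ) ^ 2 / (1024 * n) := by
      rw [le_div_iff₀ (by positivity)]
      linarith
    linarith
  have hfac : s * (N : ℝ) ^ c + 1 ≤ N * (N : ℝ) ^ c := by nlinarith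
  calc (s * (N : ℝ) ^ c + 1) * (2 * r * Real.exp (-((g : ℝ) ^ 2 / (1024 * n))))
      ≤ (N * (N : ℝ) ^ c) * (2 * N * (N : ℝ) ^ (-(5 * c))) := by gcongr
    _ = 2 * (N : ℝ) ^ (2 - 4 * c) := by
        rw [show 2 - 4 * c = 1 + c + 1 + -(5 * c) by ring, Real.rpow_add hN0, Real.rpow_add hN0,
          Real.rpow_add hN0, Real.rpow_one]
        ring
    _ ≤ 2 * (N : ℝ) ^ (-2 : ℝ) := by
        gcongr
        · linarith
        · linarith
    _ < 2 / 3 := by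
        rw [Real.rpow_neg hN0.le, Real.rpow_two, ← div_eq_mul_inv,
          div_lt_div_iff₀ (by positivity) (by norm_num)]
        nlinarith

/-- The choice of the parameters of the construction. -/
theorem exists_parameters {N r : ℕ} {c ε : ℝ} (hN : 2 ≤ N) (hc : 1 ≤ c) (hr3 : 3 ≤ r)
    (hε0 : 0 < ε) (hε : (120 * r : ℝ) ≤ 1 / ε)
    (hNr : (120 * r : ℝ) ^ 3 * (c * Real.log N) ≤ N) :
    ∃ n g : ℕ, Even n ∧ 4 ∣ g ∧ 5 * g * r ≤ n ∧ 0 < n ∧ n * r ≤ N ∧ ε < g / (6 * n) ∧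
      5120 * (c * n * Real.log N) ≤ (g : ℝ) ^ 2 := by
  have hr3R : (3 : ℝ) ≤ r := by exact_mod_cast hr3
  have hlog : (1 / 2 : ℝ) ≤ Real.log N := by
    have h1 : Real.log 2 ≤ Real.log N := Real.log_le_log (by norm_num) (by exact_mod_cast hN)
    linarith [Real.log_two_gt_d9]
  have hlog0 : 0 < Real.log N := by linarith
  have hbig : 800000 * (r : ℝ) ^ 3 ≤ N := by
    refine le_trans ?_ hNr
    have h1 : (1 / 2 : ℝ) ≤ c * Real.log N := by nlinarith
    have h2 : (0 : ℝ) ≤ (r : ℝ) ^ 3 := by positivity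
    rw [mul_pow]
    nlinarith
  have hbigN : 800000 * r ^ 3 ≤ N := by exact_mod_cast hbig
  have hr9 : 9 * r ≤ r ^ 3 := by nlinarith [Nat.mul_le_mul_left r (Nat.mul_le_mul hr3 hr3)]
  have hr3' : 3 * r ^ 2 ≤ r ^ 3 := by nlinarith [Nat.mul_le_mul_left (r ^ 2) hr3]
  set h := N / (2 * r) with hh
  set k := (2 * h) / (20 * r) with hk
  have h1 : 2 * r * h ≤ N := Nat.mul_div_le _ _
  have h2 : N < 2 * r * (h + 1) := by
    have := Nat.lt_mul_div_succ N (show 0 < 2 * r by omega)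
    simpa using this
  have h3 : 20 * r * k ≤ 2 * h := Nat.mul_div_le _ _
  have h4 : 2 * h < 20 * r * (k + 1) := by
    have := Nat.lt_mul_div_succ (2 * h) (show 0 < 20 * r by omega)
    simpa using this
  have h5 : 20 * r ≤ h := by
    rw [hh, Nat.le_div_iff_mul_le (by omega)]
    calc 20 * r * (2 * r) = 40 * r ^ 2 := by ring
      _ ≤ N := by omega
  have hk1 : 2 * h < 40 * (r * k) := by
    have : 20 * r * (k + 1) = 20 * (r * k) + 20 * r := by ring
    omega
  have hN2 : N ≤ 4 * (r * h) := by
    have : 2 * r * (h + 1) = 2 * (r * h) + 2 * r := by ring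
    have : 2 * r * 2 ≤ 2 * r * h := Nat.mul_le_mul_left _ (by omega)
    have : 2 * r * h = 2 * (r * h) := by ring
    omega
  have hk1R : (h : ℝ) < 20 * (r * k) := by
    have : h < 20 * (r * k) := by omega
    exact_mod_cast this
  have hN2R : (N : ℝ) ≤ 4 * (r * h) := by exact_mod_cast hN2
  have hh0 : (0 : ℝ) < h := by
    have : 0 < h := by omega
    exact_mod_cast this
  refine ⟨2 * h, 4 * k, even_two_mul h, dvd_mul_right 4 k, by linarith, by omega, by linarith, ?_, ?_⟩
  · push_cast
    rw [lt_div_iff₀ (by positivity)]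
    rw [le_div_iff₀ hε0] at hε
    nlinarith
  · push_cast
    have hr0 : (0 : ℝ) < r := by linarith
    have e1 : (r : ℝ) ^ 2 * (120 ^ 3 * (c * Real.log N)) ≤ 4 * h := by
      refine le_of_mul_le_mul_left ?_ hr0
      calc (r : ℝ) * ((r : ℝ) ^ 2 * (120 ^ 3 * (c * Real.log N)))
          = (120 * r : ℝ) ^ 3 * (c * Real.log N) := by ring
        _ ≤ (N : ℝ) := hNr
        _ ≤ 4 * ((r : ℝ) * h) := hN2R
        _ = (r : ℝ) * (4 * h) := by ring
    have e2 : (h : ℝ) ^ 2 ≤ 400 * ((r : ℝ) ^ 2 * k ^ 2) := by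
      calc (h : ℝ) ^ 2 ≤ (20 * ((r : ℝ) * k)) ^ 2 := by gcongr
        _ = 400 * ((r : ℝ) ^ 2 * k ^ 2) := by ring
    refine le_of_mul_le_mul_left ?_ (show (0 : ℝ) < r ^ 2 by positivity)
    nlinarith

/-- The lower bound on the number of rounds. -/
theorem rounds_lower_bound : ∃ κ : ℝ, 0 < κ ∧ ∀ (N : ℕ) (c ε : ℝ) (s : ℕ), 2 ≤ N → 1 ≤ c → 0 < ε →
    ε ≤ 1 → ∀ (Ω : Type) [MeasurableSpace Ω] (μ : Measure Ω) [IsProbabilityMeasure μ]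
        (A : Ω → RoundAlg (Fin N) ((N : ℝ) ^ c) s),
        SolvesApproxSFM μ A ε →
          κ * min (1 / ε) (((N : ℝ) / (c * Real.log N)) ^ (1 / 3 : ℝ)) ≤ s := by
  refine ⟨1 / 2000, by norm_num, fun N c ε s hN hc hε0 hε1 Ω _ μ _ A hA => ?_⟩
  rcases Nat.eq_zero_or_pos s with rfl | hs
  · exact absurd hA (rounds_ne_zero (by omega) hε1 μ A)
  by_contra! hlt
  set M := min (1 / ε) (((N : ℝ) / (c * Real.log N)) ^ (1 / 3 : ℝ)) with hM
  have hs1 : (1 : ℝ) ≤ s := by exact_mod_cast hs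
  have hM2000 : 2000 * s < M := by linarith
  have hlog0 : 0 < Real.log N := Real.log_pos (by
    have : 1 < N := by omega
    exact_mod_cast this)
  have hcl : 0 < c * Real.log N := by positivity
  obtain ⟨j, hj1, hj2⟩ : ∃ j : ℕ, (j : ℝ) ≤ (M / 120 - 3) / 6 ∧ (M / 120 - 3) / 6 < j + 1 :=
    ⟨⌊(M / 120 - 3) / 6⌋₊, Nat.floor_le (by linarith), Nat.lt_floor_add_one _⟩
  set r := 6 * j + 3 with hr
  have hrR : (r : ℝ) = 6 * j + 3 := by rw [hr]; push_cast; ring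
  have hrM : (120 * r : ℝ) ≤ M := by rw [hrR]; linarith
  have hrs : 2 * (s + 1) < r := by
    have : (2 * (s + 1) : ℝ) < r := by rw [hrR]; linarith
    exact_mod_cast this
  have hM3 : M ^ 3 * (c * Real.log N) ≤ N := by
    rw [← le_div_iff₀ hcl]
    calc M ^ 3 ≤ (((N : ℝ) / (c * Real.log N)) ^ (1 / 3 : ℝ)) ^ 3 := by
          gcongr
          exact min_le_right _ _
      _ = N / (c * Real.log N) := by
          rw [← Real.rpow_natCast, ← Real.rpow_mul (by positivity)]
          norm_num
  have hNr : (120 * r : ℝ) ^ 3 * (c * Real.log N) ≤ N := le_trans (by gcongr) hM3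
  obtain ⟨n, g, hn, hg, hgr, hn0, hnN, hεg, hgsq⟩ :=
    exists_parameters hN hc (by omega) hε0 (hrM.trans (min_le_left _ _)) hNr
  have hrN : r ≤ N := (Nat.le_mul_of_pos_left r hn0).trans hnN
  have hfail := failure_lt (s := s) (by omega) hc hn0 hrN (by omega) hgsq
  have := two_thirds_le_of_solves (Real.rpow_nonneg (Nat.cast_nonneg N) c) hn hg
    (by omega) hgr hn0 hnN hεg hrs μ A hA
  linarith

theorem mainTheorem3 :
    -- properties of the modified function
    (∀ n g r : ℕ, Even n → 4 ∣ g → Odd r → 3 ∣ r →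
      IsGridSubmodular n (hStarPrime n g r) ∧
      (∀ (i : Fin r) (x x' : Fin r → ℤ), ((i : ℕ) + 1 : ℝ) < (r : ℝ) / 2 →
        InGrid n x → InGrid n x' → IsBalanced g i x → IsBalanced g i x' →
        (∀ j, j ≤ i → x j = x' j) → ∑ j, x j = ∑ j, x' j →
        hStarPrime n g r x = hStarPrime n g r x' ∧ hStarPrime n g r x' = hFun n g r x ∧
          hFun n g r x = hFun n g r x') ∧
      (∀ (U : Type) [Fintype U] [DecidableEq U] (P : Fin r → Finset U), IsEquipartition n P →
        IsSubmodular (inducedFn P (hStarPrime n g r)) ∧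
        (5 * g * r ≤ n →
          (inducedFn P (hFun n g r) ∅ = 0 ∧ ∀ S, 0 ≤ inducedFn P (hFun n g r) S) ∧
          ((inducedFn P (hStarPrime n g r) ((lastThird r).biUnion P) : ℝ) = -((g : ℝ) * r / 6) ∧
            ∀ S, inducedFn P (hStarPrime n g r) ((lastThird r).biUnion P) ≤
              inducedFn P (hStarPrime n g r) S)))) ∧
    -- order of magnitude of the gap `g r / 6` in terms of `N = n r`
    (∃ C₁ C₂ : ℝ, 0 < C₁ ∧ 0 < C₂ ∧ ∀ (c : ℝ) (n g r : ℕ), 1 ≤ c → Even n → 4 ∣ g →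
      200 * Real.sqrt (c * n * Real.log n) ≤ g → (g : ℝ) ≤ 800 * Real.sqrt (c * n * Real.log n) →
      IsGreatest {r' : ℕ | Odd r' ∧ 3 ∣ r' ∧ 5 * g * r' ≤ n} r →
      C₁ * (((n * r : ℕ) : ℝ) ^ (2 / 3 : ℝ) * (c * Real.log (n * r : ℕ)) ^ (1 / 3 : ℝ)) ≤
          (g : ℝ) * r / 6 ∧
        (g : ℝ) * r / 6 ≤
          C₂ * (((n * r : ℕ) : ℝ) ^ (2 / 3 : ℝ) * (c * Real.log (n * r : ℕ)) ^ (1 / 3 : ℝ))) ∧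
    -- the lower bound on the number of rounds for approximate minimization
    (∃ κ : ℝ, 0 < κ ∧ ∀ (N : ℕ) (c ε : ℝ) (s : ℕ), 2 ≤ N → 1 ≤ c → 0 < ε → ε ≤ 1 →
      ∀ (Ω : Type) [MeasurableSpace Ω] (μ : Measure Ω) [IsProbabilityMeasure μ]
        (A : Ω → RoundAlg (Fin N) ((N : ℝ) ^ c) s),
        SolvesApproxSFM μ A ε →
          κ * min (1 / ε) (((N : ℝ) / (c * Real.log N)) ^ (1 / 3 : ℝ)) ≤ s) := by
  exact ⟨fun n g r hn hg _ h3 => hStarPrime_properties n g r hn hg h3, gap_order, rounds_lower_bound⟩
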